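/- **Theorem (local quadratic convergence of the Bregman iteration).** *Setting.* Let $n,p\in\mathbb N$ with $p\ge 1$. Let $\mathcal X\subseteq\mathbb R^n$ be closed and convex, and let $c:\mathbb R^n\to\mathbb R^p$ be locally Lipschitz and differentiable with locally Lipschitz gradient $\nabla c=[\nabla c_1,\dots,\nabla c_p]$. Put $\mathcal M=\{c=0\}$ and $\mathcal K=\mathcal X\cap\mathcal M$. Write $\mathcal T_{\mathcal X}$ for the Clarke tangent cone, $\mathcal N_{\mathcal X}$ for the limiting normal cone, $\mathrm{lin}(C)=C\cap(-C)$, $\mathrm{range}(C)$ for the linear span of $C$, $\mathbb B(x;r)$ for the closed ball and $\|\cdot\|$ for the Euclidean (operator) norm. A point $x\in\mathcal K$ is *nondegenerate* if $\nabla c(x)^\top\mathrm{lin}(\mathcal T_{\mathcal X}(x))=\mathbb R^p$. Let $\tau:[0,\infty)\to[0,\infty)$ be locally Lipschitz and strictly increasing with $\tau(0)=0$, and let $L_\tau$ be such that $\tau(t)\le L_\tau t$ for $t\in[0,1]$. *Projective Bregman kernel.* Let $\phi:\mathbb R^n\to\mathbb R\cup\{+\infty\}$ satisfy: 1. $\phi$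 is proper, lower semicontinuous and strictly convex, with $\mathrm{dom}(\phi)=\mathrm{int}(\mathcal X)$; 2. $\phi$ is three times continuously differentiable on $\mathrm{int}(\mathcal X)$, with $\nabla^2\phi$ invertible there, and $T_\phi(x;d)=\frac12\nabla^2\phi(x)^{-1}\big(\nabla^3\phi(x)[\nabla^2\phi(x)^{-1}d]\big)\nabla^2\phi(x)^{-1}$ is locally bounded over $\mathcal X\times\mathbb R^n$ (for each compact $S\subset\mathcal X\times\mathbb R^n$, it is bounded on the points of $S$ with $x\in\mathrm{int}(\mathcal X)$); 3. $\nabla^2\phi(\cdot)^{-1}$ extends from $\mathrm{int}(\mathcal X)$ to a locally Lipschitz map $W$ on $\mathcal X$ with $\mathrm{null}(W(x))=\mathrm{range}(\mathcal N_{\mathcal X}(x))$ for all $x\in\mathcal X$. Set $d(y)=\nabla c(y)\big(\nabla c(y)^\top W(y)\nabla c(y)+\tau(\|c(y)\|)I_p\big)^{-1}c(y)$ and $\mathcal A(y)=y-W(y)d(y)$. Consider the iteration $$x_{k+1}=(\nabla\phi)^{-1}\big(\nabla\phi(x_k)-d(x_k)\big),\tag{1}$$ where $\nabla\phi$ is regarded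 as a map on $\mathrm{int}(\mathcal X)$, and the iteration $$x_{k+1}=\arg\min_{y\in\mathbb R^n}\ \langle y-x_k,d(x_k)\rangle+D_\phi(y,x_k),\qquad D_\phi(y,x)=\phi(y)-\phi(x)-\langle\nabla\phi(x),y-x\rangle.\tag{2}$$ *Constants.* Fix a nondegenerate $x\in\mathcal K$. Let $\rho:\mathcal X\to[0,\infty)$ and $\xi:\mathbb R^n\to[0,\infty)$ be locally bounded (bounded on compact sets). With $\sigma_{\min}$ the smallest singular value, put $\sigma_Q=\sigma_{\min}(\nabla c(x)^\top W(x)\nabla c(x))$, $\sigma_c=\sigma_{\min}(\nabla c(x))$, let $\gamma$ be the supremum of the $\gamma'\in(0,1]$ with $\sigma_{\min}(\nabla c(y)^\top W(y)\nabla c(y))\ge\frac12\sigma_Q$ for all $y\in\mathbb B(x;\gamma')\cap\mathcal X$, and, with $B=\mathbb B(x;\gamma)$, $$M_c=\sup_B\|\nabla c\|,\quad M_Q=\sup_{B\cap\mathcal X}\|W\|,\quad M_\xi=\sup_B\xi,\quad L_\rho=\sup_{B\cap\mathcal X}\rho,\quad L_c=\sup_{y\ne z\in B}\tfrac{\|\nabla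 c(y)-\nabla c(z)\|}{\|y-z\|},$$ $$\delta=\min\Big\{\tfrac{\gamma}{2},\ \tfrac1{M_c},\ \tfrac{\sigma_c}{6L_c},\ \tfrac{\sigma_Q}{2M_c^2},\ \tfrac{\gamma\sigma_Q}{\sigma_Q+4M_QM_c^2},\ \tfrac{M_Q\sigma_Q}{4L_\rho M_c^2+M_\xi\sigma_Q^2},\ \tfrac{\sigma_Q^2}{(12L_\rho M_c^3+2L_\tau\sigma_Q+2L_cM_Q^2M_c^2+2\sigma_Q^2M_cM_\xi)\,2M_c}\Big\}$$ (a quotient with positive numerator and zero denominator is $+\infty$), $\delta'=\frac{\sigma_Q}{32M_QM_c^2+2\sigma_Q}\,\delta$, $\Omega_x=\mathcal X\cap\mathbb B(x;\delta)$ and $\Xi_x=\mathcal X\cap\mathbb B(x;\delta')$. Call $\rho$ *admissible* if $W$ is a projective mapping for $\mathcal X$ with $\rho$, that is, $W$ is continuous on $\mathcal X$, $W(y)$ is positive semidefinite and $\mathrm{null}(W(y))=\mathrm{range}(\mathcal N_{\mathcal X}(y))$ for $y\in\mathcal X$, and $\mathrm{dist}(y+W(y)v,\mathcal X)\le\rho(y)\|v\|^2$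 for $y\in\mathcal X$, $\|v\|\le1$. Call $\xi$ *admissible* for $\rho$ if for every $y\in\Omega_x\cap\mathrm{int}(\mathcal X)$ the point $(\nabla\phi)^{-1}(\nabla\phi(y)-d(y))$ exists and $\|\mathcal A(y)-(\nabla\phi)^{-1}(\nabla\phi(y)-d(y))\|\le\xi(y)\|c(y)\|^2$. *Conclusion.* For every nondegenerate $x\in\mathcal K$: an admissible $\rho$ exists; for each admissible $\rho$ an admissible $\xi$ exists; and for all admissible $\rho,\xi$ one has $\delta,\delta'>0$ and there is a constant $C$ such that for every $x_0\in\Xi_x\cap\mathrm{int}(\mathcal X)$ the iterations (1) and (2) are well defined, generate one and the same sequence $(x_k)$, and this sequence converges to some $x^*\in\Omega_x\cap\mathcal K$ quadratically: for all $k\ge0$, $$\|x_{k+1}-x^*\|\le C\|x_k-x^*\|^2\qquad\text{and}\qquad\mathrm{dist}(x_{k+1},\mathcal K)\le C\,\mathrm{dist}(x_k,\mathcal K)^2 .$$ -/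

import Mathlib

open Set Filter Topology
open scoped NNReal ENNReal InnerProductSpace

noncomputable section

namespace Feasibility

/-- The Euclidean space `ℝⁿ`. -/
abbrev E (n : ℕ) := EuclideanSpace ℝ (Fin n)

/-! ### Variational geometry -/

/-- Clarke tangent cone: the inner limit of `(X - x') / t` as `t ↓ 0` and `x' → x` in `X`, that is
the `v` whose distance to `(X - x') / t = {w | x' + t w ∈ X}` tends to `0`. -/
def clarkeTangentCone {n : ℕ} (X : Set (E n)) (x : E n) : Set (E n) :=
  {v | Tendsto (fun q : ℝ × E n => Metric.infDist v {w | q.2 + q.1 • w ∈ X})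
    (𝓝[>] (0 : ℝ) ×ˢ 𝓝[X] x) (𝓝 0)}

/-- Lineality space `C ∩ (-C)` of a closed convex cone `C`. -/
def lin {n : ℕ} (C : Set (E n)) : Set (E n) := {v | v ∈ C ∧ -v ∈ C}

/-- Regular (Fréchet) normal cone: `⟨v, y - x⟩ ≤ o(‖y - x‖)` for `y → x` in `X`. -/
def regularNormalCone {n : ℕ} (X : Set (E n)) (x : E n) : Set (E n) :=
  {v | ∀ ε > 0, ∀ᶠ y in 𝓝[X] x, ⟪v, y - x⟫_ℝ ≤ ε * ‖y - x‖}

/-- Limiting (Mordukhovich) normal cone: limits of regular normals at points of `X` tending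
to `x`. -/
def limitingNormalCone {n : ℕ} (X : Set (E n)) (x : E n) : Set (E n) :=
  {v | ∃ (y w : ℕ → E n), (∀ k, y k ∈ X) ∧ (∀ k, w k ∈ regularNormalCone X (y k)) ∧
    Tendsto y atTop (𝓝 x) ∧ Tendsto w atTop (𝓝 v)}

/-- A real function that is bounded on every compact subset of `X`. -/
def LocallyBoundedOn {n : ℕ} (X : Set (E n)) (f : E n → ℝ) : Prop :=
  ∀ S ⊆ X, IsCompact S → ∃ B, ∀ y ∈ S, |f y| ≤ B

/-! ### The constraint `c(x) = 0` and the restoration direction -/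

/-- `c` is locally Lipschitz and differentiable with locally Lipschitz derivative. -/
structure IsConstraintMap {n p : ℕ} (c : E n → E p) : Prop where
  differentiable : Differentiable ℝ c
  locallyLipschitz : LocallyLipschitz c
  locallyLipschitz_fderiv : LocallyLipschitz (fderiv ℝ c)

/-- `𝒦 = X ∩ {c = 0}`. -/
def feasibleSet {n p : ℕ} (X : Set (E n)) (c : E n → E p) : Set (E n) := X ∩ {y | c y = 0}

/-- The matrix `∇c(x)` with columns `∇cᵢ(x)`; its transpose is `fderiv ℝ c x`. -/
def nablac {n p : ℕ} (c : E n → E p) (x : E n) : E p →L[ℝ] E n :=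
  ContinuousLinearMap.adjoint (fderiv ℝ c x)

/-- Nondegeneracy: `∇c(x)ᵀ lin(T_X(x)) = ℝᵖ`. -/
def Nondegenerate {n p : ℕ} (X : Set (E n)) (c : E n → E p) (x : E n) : Prop :=
  fderiv ℝ c x '' lin (clarkeTangentCone X x) = univ

/-- `∇c(y)ᵀ Q(y) ∇c(y)`. -/
def gram {n p : ℕ} (c : E n → E p) (Q : E n → E n →L[ℝ] E n) (y : E n) : E p →L[ℝ] E p :=
  fderiv ℝ c y ∘L Q y ∘L nablac c y

/-- `d(y) = ∇c(y) (∇c(y)ᵀ Q(y) ∇c(y) + τ(‖c(y)‖) I)⁻¹ c(y)`. -/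
def dir {n p : ℕ} (c : E n → E p) (Q : E n → E n →L[ℝ] E n) (τ : ℝ≥0 → ℝ≥0) (y : E n) : E n :=
  nablac c y
    ((gram c Q y + (τ ‖c y‖₊ : ℝ) • ContinuousLinearMap.id ℝ (E p)).inverse (c y))

/-- `𝒜(y) = y - Q(y) d(y)`. -/
def dissolve {n p : ℕ} (c : E n → E p) (Q : E n → E n →L[ℝ] E n) (τ : ℝ≥0 → ℝ≥0) (y : E n) :
    E n :=
  y - Q y (dir c Q τ y)

/-- `Q` is a projective mapping for `X`, with `ρ` as the bounding function in the fourth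
requirement. -/
structure IsProjectiveMapping {n : ℕ} (X : Set (E n)) (Q : E n → E n →L[ℝ] E n)
    (ρ : E n → ℝ) : Prop where
  continuousOn : ContinuousOn Q X
  isPositive : ∀ y ∈ X, (Q y).IsPositive
  ker_eq : ∀ y ∈ X, LinearMap.ker (Q y : E n →ₗ[ℝ] E n) =
    Submodule.span ℝ (limitingNormalCone X y)
  nonneg : ∀ y ∈ X, 0 ≤ ρ y
  locallyBounded : LocallyBoundedOn X ρ
  infDist_le : ∀ y ∈ X, ∀ v : E n, ‖v‖ ≤ 1 → Metric.infDist (y + Q y v) X ≤ ρ y * ‖v‖ ^ 2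

/-! ### The constants attached to a point and the neighbourhoods `Ω_x`, `Ξ_x` -/

/-- Smallest singular value `min_{‖v‖ = 1} ‖A v‖` of a matrix with at least as many rows as
columns. -/
def sigmaMin {m p : ℕ} (A : E p →L[ℝ] E m) : ℝ := sInf ((fun v => ‖A v‖) '' Metric.sphere 0 1)

/-- `σ_{x,Q}`. -/
def sigmaQ {n p : ℕ} (c : E n → E p) (Q : E n → E n →L[ℝ] E n) (x : E n) : ℝ :=
  sigmaMin (gram c Q x)

/-- `σ_{x,c}`. -/
def sigmac {n p : ℕ} (c : E n → E p) (x : E n) : ℝ := sigmaMin (nablac c x)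

/-- `γ_x`. As `Q` lives on `X`, only the points of the ball that lie in `X` count. -/
def gam {n p : ℕ} (X : Set (E n)) (c : E n → E p) (Q : E n → E n →L[ℝ] E n) (x : E n) : ℝ :=
  sSup {γ | 0 < γ ∧ γ ≤ 1 ∧
    ∀ y ∈ Metric.closedBall x γ ∩ X, sigmaQ c Q x / 2 ≤ sigmaMin (gram c Q y)}

section constants

variable {n p : ℕ} (X : Set (E n)) (c : E n → E p) (Q : E n → E n →L[ℝ] E n)
  (ρ ξ : E n → ℝ) (Lτ : ℝ) (x : E n)

/-- The ball `B(x; γ_x)`. -/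
def ballx : Set (E n) := Metric.closedBall x (gam X c Q x)

/-- `M_{x,c}`. -/
def Mc : ℝ := sSup ((fun y => ‖nablac c y‖) '' ballx X c Q x)

/-- `M_{x,Q}`. -/
def MQ : ℝ := sSup ((fun y => ‖Q y‖) '' (ballx X c Q x ∩ X))

/-- `M_{x,ξ}`. -/
def Mxi : ℝ := sSup (ξ '' ballx X c Q x)

/-- `L_{x,c}`. -/
def Lc : ℝ :=
  sSup {r | ∃ y ∈ ballx X c Q x, ∃ z ∈ ballx X c Q x, y ≠ z ∧
    r = ‖nablac c y - nablac c z‖ / ‖y - z‖}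

/-- `L_{x,ρ}`. -/
def Lrho : ℝ := sSup (ρ '' (ballx X c Q x ∩ X))

/-- The quotient `a / b` of nonnegative reals, equal to `+∞` if `b = 0 < a`. -/
def quot (a b : ℝ) : ℝ≥0∞ := ENNReal.ofReal a / ENNReal.ofReal b

/-- `δ_x`. -/
def del : ℝ :=
  ENNReal.toReal <|
    quot (gam X c Q x) 2 ⊓
    quot 1 (Mc X c Q x) ⊓
    quot (sigmac c x) (6 * Lc X c Q x) ⊓
    quot (sigmaQ c Q x) (2 * Mc X c Q x ^ 2) ⊓
    quot (gam X c Q x * sigmaQ c Q x)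
      (sigmaQ c Q x + 4 * MQ X c Q x * Mc X c Q x ^ 2) ⊓
    quot (MQ X c Q x * sigmaQ c Q x)
      (4 * Lrho X c Q ρ x * Mc X c Q x ^ 2 + Mxi X c Q ξ x * sigmaQ c Q x ^ 2) ⊓
    quot (sigmaQ c Q x ^ 2)
      ((12 * Lrho X c Q ρ x * Mc X c Q x ^ 3 + 2 * Lτ * sigmaQ c Q x
        + 2 * Lc X c Q x * MQ X c Q x ^ 2 * Mc X c Q x ^ 2
        + 2 * sigmaQ c Q x ^ 2 * Mc X c Q x * Mxi X c Q ξ x) * (2 * Mc X c Q x))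

/-- `δ'_x`. -/
def del' : ℝ :=
  sigmaQ c Q x / (32 * MQ X c Q x * Mc X c Q x ^ 2 + 2 * sigmaQ c Q x) * del X c Q ρ ξ Lτ x

/-- `Ω_x = X ∩ B(x; δ_x)`. -/
def Omega : Set (E n) := X ∩ Metric.closedBall x (del X c Q ρ ξ Lτ x)

/-- `Ξ_x = X ∩ B(x; δ'_x)`. -/
def Xi : Set (E n) := X ∩ Metric.closedBall x (del' X c Q ρ ξ Lτ x)

end constants

/-! ### Bregman kernels -/

/-- `∇φ`, meaningful on the interior of the domain of `φ`. -/
def grad {n : ℕ} (φ : E n → EReal) (x : E n) : E n := gradient (fun y => (φ y).toReal) x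

/-- `∇²φ`. -/
def hess {n : ℕ} (φ : E n → EReal) (x : E n) : E n →L[ℝ] E n := fderiv ℝ (grad φ) x

/-- `T_φ(x; v) = ½ ∇²φ(x)⁻¹ (∇³φ(x)[∇²φ(x)⁻¹ v]) ∇²φ(x)⁻¹`. -/
def Tphi {n : ℕ} (φ : E n → EReal) (x v : E n) : E n →L[ℝ] E n :=
  (1 / 2 : ℝ) • ((hess φ x).inverse ∘L (fderiv ℝ (hess φ) x ((hess φ x).inverse v)) ∘L
    (hess φ x).inverse)

/-- `φ : ℝⁿ → ℝ ∪ {+∞}` is a projective Bregman kernel for `X`, and `W` is the extension of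
`∇²φ(·)⁻¹` from the interior of `X` to `X`. -/
structure IsProjectiveBregmanKernel {n : ℕ} (X : Set (E n)) (φ : E n → EReal)
    (W : E n → E n →L[ℝ] E n) : Prop where
  ne_bot : ∀ y, φ y ≠ ⊥
  proper : ∃ y, φ y < ⊤
  lsc : LowerSemicontinuous φ
  dom_eq : {y | φ y < ⊤} = interior X
  strictConvex : StrictConvexOn ℝ {y | φ y < ⊤} (fun y => (φ y).toReal)
  contDiffOn : ContDiffOn ℝ 3 (fun y => (φ y).toReal) (interior X)
  T_locallyBounded : ∀ S ⊆ X ×ˢ (univ : Set (E n)), IsCompact S →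
    ∃ B, ∀ q ∈ S, q.1 ∈ interior X → ‖Tphi φ q.1 q.2‖ ≤ B
  hess_invertible : ∀ y ∈ interior X, (hess φ y).IsInvertible
  W_eq : ∀ y ∈ interior X, W y = (hess φ y).inverse
  W_locallyLipschitzOn : LocallyLipschitzOn X W
  ker_W : ∀ y ∈ X, LinearMap.ker (W y : E n →ₗ[ℝ] E n) =
    Submodule.span ℝ (limitingNormalCone X y)

/-- Bregman divergence `D_φ(y, x) = φ(y) - φ(x) - ⟨∇φ(x), y - x⟩`, for `x` in the domain. -/
def bregmanDiv {n : ℕ} (φ : E n → EReal) (y x : E n) : EReal :=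
  φ y - φ x - ((⟪grad φ x, y - x⟫_ℝ : ℝ) : EReal)

/-- `z ∈ argmin_y ⟨y - x, d⟩ + D_φ(y, x)`. -/
def IsProxStep {n : ℕ} (φ : E n → EReal) (d x z : E n) : Prop :=
  IsMinOn (fun y => ((⟪y - x, d⟫_ℝ : ℝ) : EReal) + bregmanDiv φ y x) univ z

/-- `z = (∇φ)⁻¹(∇φ(x) - d)`, where `∇φ` is a map on the domain of `φ`. -/
def IsMirrorStep {n : ℕ} (φ : E n → EReal) (d x z : E n) : Prop :=
  φ z < ⊤ ∧ grad φ z = grad φ x - d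

/-- `ξ` bounds the error `r_B(y) = 𝒜(y) - (∇φ)⁻¹(∇φ(y) - d(y))` by `ξ(y) ‖c(y)‖²` on `Ω_x`. -/
structure IsErrorBound {n p : ℕ} (X : Set (E n)) (c : E n → E p) (φ : E n → EReal)
    (W : E n → E n →L[ℝ] E n) (τ : ℝ≥0 → ℝ≥0) (Lτ : ℝ) (ρ : E n → ℝ) (x : E n)
    (ξ : E n → ℝ) : Prop where
  nonneg : ∀ y, 0 ≤ ξ y
  locallyBounded : LocallyBoundedOn univ ξ
  bound : ∀ y ∈ Omega X c W ρ ξ Lτ x ∩ interior X, ∃ z, IsMirrorStep φ (dir c W τ y) y z ∧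
    ‖dissolve c W τ y - z‖ ≤ ξ y * ‖c y‖ ^ 2

end Feasibility

end

open Feasibility

/-! The violation `‖c‖` drives everything. The map `dissolve` is a regularised Newton step for `c =
0`: linearising `c` at `y` along it leaves only `τ(‖c(y)‖)` times the multiplier, which is
`O(‖c(y)‖²)`. The step has length `O(‖c(y)‖)`, so the Taylor remainder is `O(‖c(y)‖²)` as well. The
inverse in the step is under control because nondegeneracy makes the Gram matrix positive definite
at `x`: `lin T_X(x)` is orthogonal to the kernel of `W x`, and its image under `∇c(x)ᵀ` is
everything (`sigmaQ_pos`).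

The mirror step is `dissolve` up to `O(‖d‖²)` (`exists_grad_eq_norm_sub_le`). A bound on `W =
(∇²φ)⁻¹` makes `∇φ` locally strongly monotone, so `∇φ` has a Lipschitz inverse on a ball of uniform
radius, with derivative `W` at the preimage; a Lipschitz bound on `W` then controls the error of the
linearisation. Only `W` enters, never the size of the Hessian, so the estimates are uniform up to
the boundary of `X`. This one lemma yields both an admissible `ρ` and an admissible `ξ`.

The constants in `δ` make each step from `Ω_x` at least halve `‖c‖` (`norm_apply_step_le_half`).
Step lengths are `O(‖c‖)`, so they sum geometrically: the iterates stay near `x` and converge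
(`iterate_mem`, `exists_tendsto`), with distance to the limit `O(‖c(u k)‖)`. Combined with `‖c(u
(k+1))‖ = O(‖c(u k)‖²)` and the Lipschitz bound of `‖c‖` by the distance to feasible points, this
gives both quadratic rates (`exists_quadratic_limit`). -/

namespace Feasibility

/-! ### Positive operators and their regularised inverses. -/

section operators

variable {F G : Type*} [NormedAddCommGroup F] [InnerProductSpace ℝ F]

/-- Cauchy–Schwarz for the semidefinite form `⟪T u, v⟫`, through the discriminant of `t ↦ ⟪T (w + t
T w), w + t T w⟫`. Applied with `T = W z` and `w = ∇²φ(z) u`, it turns an upper bound on `W` into a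
lower bound on the Hessian. -/
theorem norm_sq_le_of_isPositive {T : F →L[ℝ] F} (hT : T.IsPositive) (w : F) :
    ‖T w‖ ^ 2 ≤ ‖T‖ * ⟪T w, w⟫_ℝ := by
  have h0 : ∀ v, 0 ≤ ⟪T v, v⟫_ℝ := hT.inner_nonneg_left
  have hsym : ∀ u v, ⟪T u, v⟫_ℝ = ⟪u, T v⟫_ℝ := hT.inner_left_eq_inner_right
  have hb : ⟪T (T w), T w⟫_ℝ ≤ ‖T‖ * ‖T w‖ ^ 2 :=
    calc ⟪T (T w), T w⟫_ℝ ≤ ‖T (T w)‖ * ‖T w‖ := real_inner_le_norm _ _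
      _ ≤ ‖T‖ * ‖T w‖ * ‖T w‖ := by gcongr; exact T.le_opNorm _
      _ = ‖T‖ * ‖T w‖ ^ 2 := by ring
  have hq : ∀ t : ℝ, 0 ≤ ⟪T (T w), T w⟫_ℝ * (t * t) + 2 * ‖T w‖ ^ 2 * t + ⟪T w, w⟫_ℝ := by
    intro t
    have := h0 (w + t • T w)
    simp only [map_add, map_smul, inner_add_left, inner_add_right, inner_smul_left,
      inner_smul_right, hsym (T w) w, real_inner_self_eq_norm_sq, conj_trivial] at this
    nlinarith
  have hd := discrim_le_zero hq
  rw [discrim] at hd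
  rcases (sq_nonneg ‖T w‖).eq_or_lt with h | h
  · rw [← h]; exact mul_nonneg (norm_nonneg _) (h0 w)
  · have h1 : ‖T w‖ ^ 2 * ‖T w‖ ^ 2 ≤ ‖T w‖ ^ 2 * (‖T‖ * ⟪T w, w⟫_ℝ) := by
      nlinarith [mul_le_mul_of_nonneg_right hb (h0 w)]
    exact le_of_mul_le_mul_left h1 h

theorem apply_eq_zero_of_inner_eq_zero {T : F →L[ℝ] F} (hT : T.IsPositive) {w : F}
    (h : ⟪T w, w⟫_ℝ = 0) : T w = 0 := by
  have := norm_sq_le_of_isPositive hT w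
  rw [h, mul_zero] at this
  exact norm_eq_zero.1 (pow_eq_zero_iff two_ne_zero |>.1 (le_antisymm this (sq_nonneg _)))

/-- Positivity makes the cross term nonnegative, so the regularisation `τ(‖c‖) I` never worsens the
lower bound on the Gram matrix. -/
theorem norm_le_norm_add_smul {T : F →L[ℝ] F} (hT : T.IsPositive) {t : ℝ} (ht : 0 ≤ t) (v : F) :
    ‖T v‖ ≤ ‖T v + t • v‖ := by
  have h := norm_add_sq_real (T v) (t • v)
  rw [inner_smul_right] at h
  have h0 : 0 ≤ ⟪T v, v⟫_ℝ := hT.inner_nonneg_left v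
  refine le_of_sq_le_sq ?_ (norm_nonneg _)
  nlinarith [mul_nonneg ht h0, sq_nonneg ‖t • v‖]

variable [FiniteDimensional ℝ F]

theorem isInvertible_of_mul_norm_le {T : F →L[ℝ] F} {σ : ℝ} (hσ : 0 < σ)
    (h : ∀ v, σ * ‖v‖ ≤ ‖T v‖) : T.IsInvertible := by
  have hinj : Function.Injective T := by
    refine (injective_iff_map_eq_zero T).2 fun v hv => ?_
    have := h v
    rw [hv, norm_zero] at this
    exact norm_eq_zero.1 (le_antisymm (by nlinarith [norm_nonneg v]) (norm_nonneg v))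
  exact ⟨(LinearEquiv.ofInjectiveEndo (T : F →ₗ[ℝ] F) hinj).toContinuousLinearEquiv, by ext; rfl⟩

theorem isInvertible_add_smul_id {T : F →L[ℝ] F} (hT : T.IsPositive) {σ t : ℝ} (hσ : 0 < σ)
    (h : ∀ v, σ * ‖v‖ ≤ ‖T v‖) (ht : 0 ≤ t) :
    (T + t • ContinuousLinearMap.id ℝ F).IsInvertible :=
  isInvertible_of_mul_norm_le hσ fun v => (h v).trans (norm_le_norm_add_smul hT ht v)

theorem mul_norm_inverse_add_smul_id_le {T : F →L[ℝ] F} (hT : T.IsPositive) {σ t : ℝ}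
    (hσ : 0 < σ) (h : ∀ v, σ * ‖v‖ ≤ ‖T v‖) (ht : 0 ≤ t) (w : F) :
    σ * ‖(T + t • ContinuousLinearMap.id ℝ F).inverse w‖ ≤ ‖w‖ := by
  set q := (T + t • ContinuousLinearMap.id ℝ F).inverse w with hq
  have hw : T q + t • q = w := (isInvertible_add_smul_id hT hσ h ht).self_apply_inverse w
  calc σ * ‖q‖ ≤ ‖T q‖ := h q
    _ ≤ ‖T q + t • q‖ := norm_le_norm_add_smul hT ht q
    _ = ‖w‖ := by rw [hw]

end operators

/-! ### The smallest singular value. -/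

section sigmaMin

variable {m p : ℕ}

theorem bddBelow_image_norm_sphere (A : E p →L[ℝ] E m) :
    BddBelow ((fun v => ‖A v‖) '' Metric.sphere 0 1) :=
  ⟨0, by rintro _ ⟨v, -, rfl⟩; exact norm_nonneg _⟩

theorem sigmaMin_mul_norm_le (A : E p →L[ℝ] E m) (v : E p) : sigmaMin A * ‖v‖ ≤ ‖A v‖ := by
  rcases eq_or_ne v 0 with rfl | hv
  · simp
  have hv' : 0 < ‖v‖ := norm_pos_iff.2 hv
  have : sigmaMin A ≤ ‖A (‖v‖⁻¹ • v)‖ := by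
    refine csInf_le (bddBelow_image_norm_sphere A) ⟨_, ?_, rfl⟩
    rw [mem_sphere_zero_iff_norm, norm_smul, norm_inv, norm_norm, inv_mul_cancel₀ hv'.ne']
  rw [map_smul, norm_smul, norm_inv, norm_norm] at this
  calc sigmaMin A * ‖v‖ ≤ ‖v‖⁻¹ * ‖A v‖ * ‖v‖ := by gcongr
    _ = ‖A v‖ := by field_simp

/-- This is where `0 < p` enters: for `p = 0` the sphere is empty and `sigmaMin` takes the default
value `0`. -/
theorem nonempty_sphere (hp : 0 < p) : (Metric.sphere (0 : E p) 1).Nonempty := by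
  have : Nonempty (Fin p) := ⟨⟨0, hp⟩⟩
  exact NormedSpace.sphere_nonempty.2 zero_le_one

theorem exists_sigmaMin_eq (hp : 0 < p) (A : E p →L[ℝ] E m) :
    ∃ v, ‖v‖ = 1 ∧ sigmaMin A = ‖A v‖ := by
  obtain ⟨v, hv, h⟩ := (isCompact_sphere (0 : E p) 1).exists_sInf_image_eq (nonempty_sphere hp)
    (f := fun v => ‖A v‖) (by fun_prop)
  exact ⟨v, by simpa using hv, h⟩

theorem sigmaMin_pos (hp : 0 < p) {A : E p →L[ℝ] E m} (hA : ∀ v, A v = 0 → v = 0) :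
    0 < sigmaMin A := by
  obtain ⟨v, hv, h⟩ := exists_sigmaMin_eq hp A
  rw [h, norm_pos_iff]
  intro h0
  rw [hA v h0, norm_zero] at hv
  exact zero_ne_one hv

theorem sigmaMin_le_opNorm (hp : 0 < p) (A : E p →L[ℝ] E m) : sigmaMin A ≤ ‖A‖ := by
  obtain ⟨v, hv, h⟩ := exists_sigmaMin_eq hp A
  simpa [h, hv] using A.le_opNorm v

theorem sigmaMin_le_add (hp : 0 < p) (A B : E p →L[ℝ] E m) :
    sigmaMin A ≤ sigmaMin B + ‖A - B‖ := by
  obtain ⟨v, hv, h⟩ := exists_sigmaMin_eq hp B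
  have h1 := sigmaMin_mul_norm_le A v
  have h2 := (A - B).le_opNorm v
  have h3 := norm_add_le (B v) ((A - B) v)
  rw [hv, mul_one] at h1 h2
  rw [sub_apply, add_sub_cancel] at h3
  rw [sub_apply] at h2
  rw [h]
  linarith

theorem continuous_sigmaMin (hp : 0 < p) :
    Continuous (sigmaMin : (E p →L[ℝ] E m) → ℝ) := by
  refine (LipschitzWith.of_le_add_mul 1 fun A B => ?_).continuous
  simpa [dist_eq_norm] using sigmaMin_le_add hp A B

end sigmaMin

/-! ### Normal and tangent cones, and the consequences of nondegeneracy. -/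

section variational

variable {n p : ℕ} {X : Set (E n)}

theorem inner_le_zero_of_mem_regularNormalCone (hX : Convex ℝ X) {y z v : E n} (hy : y ∈ X)
    (hz : z ∈ X) (hv : v ∈ regularNormalCone X y) : ⟪v, z - y⟫_ℝ ≤ 0 := by
  have hlim : Tendsto (fun t : ℝ => y + t • (z - y)) (𝓝[>] 0) (𝓝[X] y) := by
    refine tendsto_nhdsWithin_iff.2 ⟨?_, ?_⟩
    · have : Continuous fun t : ℝ => y + t • (z - y) := by fun_prop
      simpa using (this.tendsto 0).mono_left nhdsWithin_le_nhds
    · filter_upwards [Ioc_mem_nhdsGT (zero_lt_one' ℝ)] with t ht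
      exact hX.add_smul_sub_mem hy hz ⟨ht.1.le, ht.2⟩
  have key : ∀ ε > 0, ⟪v, z - y⟫_ℝ ≤ ε * ‖z - y‖ := by
    intro ε hε
    obtain ⟨t, ht, ht0⟩ := ((hlim.eventually (hv ε hε)).and self_mem_nhdsWithin).exists
    have ht0 : (0 : ℝ) < t := ht0
    rw [add_sub_cancel_left, inner_smul_right, norm_smul, Real.norm_of_nonneg ht0.le] at ht
    refine le_of_mul_le_mul_left ?_ ht0
    linarith
  have hlim' : Tendsto (fun ε : ℝ => ε * ‖z - y‖) (𝓝[>] 0) (𝓝 0) := by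
    have : Continuous fun ε : ℝ => ε * ‖z - y‖ := by fun_prop
    simpa using (this.tendsto 0).mono_left nhdsWithin_le_nhds
  refine ge_of_tendsto hlim' ?_
  filter_upwards [self_mem_nhdsWithin] with ε hε using key ε hε

theorem inner_le_zero_of_mem_limitingNormalCone (hX : Convex ℝ X) {x z w : E n} (hz : z ∈ X)
    (hw : w ∈ limitingNormalCone X x) : ⟪w, z - x⟫_ℝ ≤ 0 := by
  obtain ⟨y, v, hy, hv, hyx, hvw⟩ := hw
  exact le_of_tendsto (hvw.inner (tendsto_const_nhds.sub hyx))
    (Eventually.of_forall fun k => inner_le_zero_of_mem_regularNormalCone hX (hy k) hz (hv k))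

/-- Taking the base point constantly equal to `x` in the inner limit suffices. A normal `w` is
nonpositive on `(X - x) / t` by convexity, hence at most `‖w‖` times the distance of `v` to that
set, and this distance tends to `0`. -/
theorem inner_le_zero_of_mem_clarkeTangentCone (hX : Convex ℝ X) {x v w : E n} (hx : x ∈ X)
    (hw : w ∈ limitingNormalCone X x) (hv : v ∈ clarkeTangentCone X x) : ⟪w, v⟫_ℝ ≤ 0 := by
  have hlim : Tendsto (fun t : ℝ => Metric.infDist v {u | x + t • u ∈ X}) (𝓝[>] 0) (𝓝 0) :=
    Tendsto.comp (f := fun t : ℝ => (t, x)) hv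
      (tendsto_id.prodMk (tendsto_nhdsWithin_of_tendsto_nhds_of_eventually_within _
        tendsto_const_nhds (Eventually.of_forall fun _ => hx)))
  have key : ∀ t : ℝ, 0 < t → ⟪w, v⟫_ℝ ≤ ‖w‖ * Metric.infDist v {u | x + t • u ∈ X} := by
    intro t ht
    have hne : ({u | x + t • u ∈ X} : Set (E n)).Nonempty := ⟨0, by simpa using hx⟩
    refine le_of_forall_pos_lt_add fun ε hε => ?_
    obtain ⟨u, hu, huv⟩ := (Metric.infDist_lt_iff hne).1
      (lt_add_of_pos_right (Metric.infDist v {u | x + t • u ∈ X})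
        (show 0 < ε / (‖w‖ + 1) by positivity))
    have h1 : ⟪w, u⟫_ℝ ≤ 0 := by
      have := inner_le_zero_of_mem_limitingNormalCone hX hu hw
      rw [add_sub_cancel_left, inner_smul_right] at this
      exact nonpos_of_mul_nonpos_right this ht
    have h2 : ⟪w, v - u⟫_ℝ ≤ ‖w‖ * dist v u := by
      rw [dist_eq_norm]; exact real_inner_le_norm _ _
    have h3 : ‖w‖ * (ε / (‖w‖ + 1)) < ε := by
      rw [mul_div_assoc', div_lt_iff₀ (by positivity)]
      nlinarith
    rw [inner_sub_right] at h2
    nlinarith [mul_le_mul_of_nonneg_left huv.le (norm_nonneg w)]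
  have := hlim.const_mul ‖w‖
  rw [mul_zero] at this
  refine ge_of_tendsto this ?_
  filter_upwards [self_mem_nhdsWithin] with t ht using key t ht

theorem inner_eq_zero_of_mem_lin_clarkeTangentCone (hX : Convex ℝ X) {x v w : E n} (hx : x ∈ X)
    (hw : w ∈ Submodule.span ℝ (limitingNormalCone X x))
    (hv : v ∈ lin (clarkeTangentCone X x)) : ⟪w, v⟫_ℝ = 0 := by
  have hle : Submodule.span ℝ (limitingNormalCone X x) ≤ (ℝ ∙ v)ᗮ := by
    refine Submodule.span_le.2 fun u hu => ?_
    rw [SetLike.mem_coe, Submodule.mem_orthogonal_singleton_iff_inner_left]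
    have h1 := inner_le_zero_of_mem_clarkeTangentCone hX hx hu hv.1
    have h2 := inner_le_zero_of_mem_clarkeTangentCone hX hx hu hv.2
    rw [inner_neg_right] at h2
    linarith
  exact Submodule.mem_orthogonal_singleton_iff_inner_left.1 (hle hw)

variable {c : E n → E p} {W : E n → E n →L[ℝ] E n}

theorem inner_nablac (y : E n) (q : E p) (v : E n) :
    ⟪nablac c y q, v⟫_ℝ = ⟪q, fderiv ℝ c y v⟫_ℝ :=
  ContinuousLinearMap.adjoint_inner_left _ _ _

theorem norm_nablac (y : E n) : ‖nablac c y‖ = ‖fderiv ℝ c y‖ :=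
  LinearIsometryEquiv.norm_map _ _

theorem isPositive_gram {y : E n} (hW : (W y).IsPositive) : (gram c W y).IsPositive := by
  have := hW.conj_adjoint (fderiv ℝ c y)
  exact this

/-- Write `q = ∇c(x)ᵀ v` with `v` in the lineality space. Since `∇c(x) q` lies in the span of the
normals, which is orthogonal to `v`, `‖q‖² = ⟪∇c(x) q, v⟫ = 0`. -/
theorem Nondegenerate.eq_zero_of_apply_mem_ker (hX : Convex ℝ X) {x : E n} (hx : x ∈ X)
    (hker : LinearMap.ker (W x : E n →ₗ[ℝ] E n) = Submodule.span ℝ (limitingNormalCone X x))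
    (hnd : Nondegenerate X c x) {q : E p} (hq : W x (nablac c x q) = 0) : q = 0 := by
  have hmem : nablac c x q ∈ Submodule.span ℝ (limitingNormalCone X x) := by
    rw [← hker]; exact hq
  obtain ⟨v, hv, hvq⟩ : q ∈ fderiv ℝ c x '' lin (clarkeTangentCone X x) := by
    rw [hnd]; trivial
  have := inner_eq_zero_of_mem_lin_clarkeTangentCone hX hx hmem hv
  rw [inner_nablac, hvq] at this
  exact inner_self_eq_zero.1 this

theorem sigmaQ_pos (hp : 0 < p) (hX : Convex ℝ X) {x : E n} (hx : x ∈ X)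
    (hW : (W x).IsPositive)
    (hker : LinearMap.ker (W x : E n →ₗ[ℝ] E n) = Submodule.span ℝ (limitingNormalCone X x))
    (hnd : Nondegenerate X c x) : 0 < sigmaQ c W x := by
  refine sigmaMin_pos hp fun q hq => hnd.eq_zero_of_apply_mem_ker hX hx hker
    (apply_eq_zero_of_inner_eq_zero hW ?_)
  have h : ⟪gram c W x q, q⟫_ℝ = 0 := by rw [hq, inner_zero_left]
  rw [real_inner_comm, inner_nablac, real_inner_comm]
  exact h

theorem sigmac_pos (hp : 0 < p) (hX : Convex ℝ X) {x : E n} (hx : x ∈ X)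
    (hker : LinearMap.ker (W x : E n →ₗ[ℝ] E n) = Submodule.span ℝ (limitingNormalCone X x))
    (hnd : Nondegenerate X c x) : 0 < sigmac c x :=
  sigmaMin_pos hp fun q hq =>
    hnd.eq_zero_of_apply_mem_ker hX hx hker (by rw [hq, map_zero])

end variational

/-! ### First- and second-order properties of the kernel. -/

namespace IsProjectiveBregmanKernel

variable {n : ℕ} {X : Set (E n)} {φ : E n → EReal} {W : E n → E n →L[ℝ] E n}

section firstOrder

variable (hφ : IsProjectiveBregmanKernel X φ W)

include hφ

theorem lt_top_iff {y : E n} : φ y < ⊤ ↔ y ∈ interior X := by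
  rw [← hφ.dom_eq]; rfl

theorem coe_toReal {y : E n} (hy : y ∈ interior X) : ((φ y).toReal : EReal) = φ y :=
  EReal.coe_toReal (hφ.lt_top_iff.2 hy).ne (hφ.ne_bot y)

theorem eq_top {y : E n} (hy : y ∉ interior X) : φ y = ⊤ := by
  rw [← hφ.lt_top_iff] at hy
  exact not_lt_top_iff.1 hy

theorem convexOn : ConvexOn ℝ (interior X) fun y => (φ y).toReal := by
  have := hφ.strictConvex.convexOn
  rwa [hφ.dom_eq] at this

theorem nonempty_interior : (interior X).Nonempty :=
  hφ.proper.imp fun _ hy => hφ.lt_top_iff.1 hy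

theorem hasGradientAt {y : E n} (hy : y ∈ interior X) :
    HasGradientAt (fun y => (φ y).toReal) (grad φ y) y :=
  ((hφ.contDiffOn.contDiffAt (isOpen_interior.mem_nhds hy)).differentiableAt
    (by norm_num)).hasGradientAt

/-- An invertible `fderiv` cannot be the default value `0` at a point of non-differentiability (on
the zero space every map is differentiable). -/
theorem hasFDerivAt_grad {y : E n} (hy : y ∈ interior X) :
    HasFDerivAt (grad φ) (hess φ y) y :=
  (differentiableAt_of_isInvertible_fderiv (hφ.hess_invertible y hy)).hasFDerivAt

theorem hasDerivAt_line {y : E n} (hy : y ∈ interior X) (u : E n) :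
    HasDerivAt (fun t : ℝ => (φ (y + t • u)).toReal) ⟪grad φ y, u⟫_ℝ 0 := by
  have h1 : HasDerivAt (fun t : ℝ => y + t • u) u 0 := by
    simpa using ((hasDerivAt_id (0 : ℝ)).smul_const u).const_add y
  have h2 : HasFDerivAt (fun y => (φ y).toReal)
      (InnerProductSpace.toDual ℝ (E n) (grad φ y)) (y + (0 : ℝ) • u) := by
    rw [zero_smul, add_zero]; exact (hφ.hasGradientAt hy).hasFDerivAt
  exact h2.comp_hasDerivAt (0 : ℝ) h1

theorem add_inner_grad_le {y z : E n} (hy : y ∈ interior X) (hz : z ∈ interior X) :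
    (φ z).toReal + ⟪grad φ z, y - z⟫_ℝ ≤ (φ y).toReal := by
  have hlim := (hφ.hasDerivAt_line hz (y - z)).tendsto_slope_zero_right
  rw [← le_sub_iff_add_le']
  refine le_of_tendsto hlim ?_
  filter_upwards [Ioc_mem_nhdsGT (zero_lt_one' ℝ)] with t ht
  have hc := hφ.convexOn.2 hz hy (sub_nonneg.2 ht.2) ht.1.le (sub_add_cancel 1 t)
  have he : (1 - t) • z + t • y = z + (0 + t) • (y - z) := by module
  rw [he] at hc
  simp only [smul_eq_mul, zero_smul, add_zero] at hc ⊢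
  rw [inv_mul_le_iff₀ ht.1]
  linarith

theorem inner_grad_sub_nonneg {y z : E n} (hy : y ∈ interior X) (hz : z ∈ interior X) :
    0 ≤ ⟪grad φ y - grad φ z, y - z⟫_ℝ := by
  have h1 := hφ.add_inner_grad_le hy hz
  have h2 := hφ.add_inner_grad_le hz hy
  rw [← neg_sub y z, inner_neg_right] at h2
  rw [inner_sub_left]
  linarith

/-- With equal gradients at `a` and `b`, the two tangent inequalities at the midpoint add up to
`φ(a) + φ(b) ≤ 2 φ(midpoint)`, against strict convexity. -/
theorem injOn_grad : InjOn (grad φ) (interior X) := by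
  intro a ha b hb hab
  by_contra hne
  have hs := hφ.strictConvex
  rw [hφ.dom_eq] at hs
  have hm := hs.1 ha hb (by norm_num : (0 : ℝ) ≤ 1 / 2) (by norm_num : (0 : ℝ) ≤ 1 / 2)
    (by norm_num)
  have h := hs.2 ha hb hne (by norm_num : (0 : ℝ) < 1 / 2) (by norm_num : (0 : ℝ) < 1 / 2)
    (by norm_num)
  have h1 := hφ.add_inner_grad_le hm ha
  have h2 := hφ.add_inner_grad_le hm hb
  have e1 : (1 / 2 : ℝ) • a + (1 / 2 : ℝ) • b - a = -((1 / 2 : ℝ) • (a - b)) := by module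
  have e2 : (1 / 2 : ℝ) • a + (1 / 2 : ℝ) • b - b = (1 / 2 : ℝ) • (a - b) := by module
  rw [e1, inner_neg_right, hab] at h1
  rw [e2] at h2
  simp only [smul_eq_mul] at h
  linarith

theorem grad_eq_of_eventually_le {z b : E n} (hz : z ∈ interior X)
    (h : ∀ᶠ w in 𝓝 z, (φ z).toReal - ⟪b, z⟫_ℝ ≤ (φ w).toReal - ⟪b, w⟫_ℝ) : grad φ z = b := by
  have hd : HasFDerivAt (fun w => (φ w).toReal - ⟪b, w⟫_ℝ)
      (InnerProductSpace.toDual ℝ (E n) (grad φ z) - innerSL ℝ b) z :=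
    (hφ.hasGradientAt hz).hasFDerivAt.sub (innerSL ℝ b).hasFDerivAt
  have hmin : IsLocalMin (fun w => (φ w).toReal - ⟪b, w⟫_ℝ) z := h
  have h0 := hmin.hasFDerivAt_eq_zero hd
  have h1 : ∀ v, ⟪grad φ z, v⟫_ℝ = ⟪b, v⟫_ℝ := fun v => by
    have := congrArg (fun T : E n →L[ℝ] ℝ => T v) h0
    exact sub_eq_zero.1 this
  exact ext_inner_right ℝ h1

end firstOrder

section secondOrder

variable (hφ : IsProjectiveBregmanKernel X φ W)

include hφ

theorem inner_hess_comm {y : E n} (hy : y ∈ interior X) (u v : E n) :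
    ⟪hess φ y u, v⟫_ℝ = ⟪u, hess φ y v⟫_ℝ := by
  have hs : IsSymmSndFDerivAt ℝ (fun y => (φ y).toReal) y :=
    (hφ.contDiffOn.contDiffAt (isOpen_interior.mem_nhds hy)).isSymmSndFDerivAt (by
      rw [minSmoothness_of_isRCLikeNormedField]; norm_num)
  have he : fderiv ℝ (fun y => (φ y).toReal) = fun y => innerSL ℝ (grad φ y) := by
    funext y
    exact (toDual_gradient (𝕜 := ℝ) (f := fun y => (φ y).toReal) (x := y)).symm
  have hd : HasFDerivAt (fun y => innerSL ℝ (grad φ y)) ((innerSL ℝ).comp (hess φ y)) y :=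
    (innerSL ℝ).hasFDerivAt.comp y (hφ.hasFDerivAt_grad hy)
  have h := hs u v
  rw [he, hd.fderiv] at h
  have h' : ⟪hess φ y u, v⟫_ℝ = ⟪hess φ y v, u⟫_ℝ := h
  rw [h', real_inner_comm]

theorem inner_hess_nonneg {y : E n} (hy : y ∈ interior X) (u : E n) :
    0 ≤ ⟪hess φ y u, u⟫_ℝ := by
  have hlim : Tendsto (fun t : ℝ => ⟪t⁻¹ • (grad φ (y + t • u) - grad φ y), u⟫_ℝ) (𝓝[>] 0)
      (𝓝 ⟪hess φ y u, u⟫_ℝ) := by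
    have h1 : HasDerivAt (fun t : ℝ => y + t • u) u 0 := by
      simpa using ((hasDerivAt_id (0 : ℝ)).smul_const u).const_add y
    have h2 : HasFDerivAt (grad φ) (hess φ y) (y + (0 : ℝ) • u) := by
      rw [zero_smul, add_zero]; exact hφ.hasFDerivAt_grad hy
    have h3 := (h2.comp_hasDerivAt (0 : ℝ) h1).tendsto_slope_zero_right
    simpa using h3.inner tendsto_const_nhds
  have hint : ∀ᶠ t : ℝ in 𝓝[>] 0, y + t • u ∈ interior X := by
    have : Continuous fun t : ℝ => y + t • u := by fun_prop
    refine ((this.tendsto 0).mono_left nhdsWithin_le_nhds).eventually ?_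
    rw [zero_smul, add_zero]
    exact isOpen_interior.mem_nhds hy
  refine ge_of_tendsto hlim ?_
  filter_upwards [hint, self_mem_nhdsWithin] with t ht ht0
  have ht0 : 0 < t := ht0
  have h := hφ.inner_grad_sub_nonneg ht hy
  rw [add_sub_cancel_left, inner_smul_right] at h
  rw [inner_smul_left]
  exact mul_nonneg (by simpa using ht0.le) (nonneg_of_mul_nonneg_right h ht0)

theorem W_hess {y : E n} (hy : y ∈ interior X) (u : E n) : W y (hess φ y u) = u := by
  rw [hφ.W_eq y hy]; exact (hφ.hess_invertible y hy).inverse_apply_self u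

theorem hess_W {y : E n} (hy : y ∈ interior X) (u : E n) : hess φ y (W y u) = u := by
  rw [hφ.W_eq y hy]; exact (hφ.hess_invertible y hy).self_apply_inverse u

theorem isPositive_W_of_mem_interior {y : E n} (hy : y ∈ interior X) : (W y).IsPositive := by
  rw [ContinuousLinearMap.isPositive_iff]
  refine ⟨fun a b => ?_, fun a => ?_⟩
  · have := hφ.inner_hess_comm hy (W y a) (W y b)
    rw [hφ.hess_W hy, hφ.hess_W hy] at this
    exact this.symm
  · have := hφ.inner_hess_nonneg hy (W y a)
    rw [hφ.hess_W hy] at this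
    rwa [real_inner_comm]

theorem mem_closure_interior (hX : Convex ℝ X) {y : E n} (hy : y ∈ X) :
    y ∈ closure (interior X) := by
  rw [hX.closure_interior_eq_closure_of_nonempty_interior hφ.nonempty_interior]
  exact subset_closure hy

/-- `W` is the inverse of a symmetric positive Hessian in the interior; symmetry and positivity pass
to the boundary by continuity, as the interior is dense in `X`. -/
theorem isPositive_W (hX : Convex ℝ X) {y : E n} (hy : y ∈ X) : (W y).IsPositive := by
  have hne : (𝓝[interior X] y).NeBot :=
    mem_closure_iff_nhdsWithin_neBot.1 (hφ.mem_closure_interior hX hy)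
  have hlim : ∀ u, Tendsto (fun z => W z u) (𝓝[interior X] y) (𝓝 (W y u)) := fun u =>
    ((ContinuousLinearMap.apply ℝ (E n) u).continuous.tendsto _).comp
      ((hφ.W_locallyLipschitzOn.continuousOn y hy).mono_left
        (nhdsWithin_mono y interior_subset))
  rw [ContinuousLinearMap.isPositive_iff]
  refine ⟨fun a b => ?_, fun a => ?_⟩
  · refine tendsto_nhds_unique_of_eventuallyEq ((hlim a).inner (tendsto_const_nhds (x := b)))
      ((tendsto_const_nhds (x := a)).inner (hlim b)) ?_
    filter_upwards [self_mem_nhdsWithin] with z hz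
    exact (hφ.isPositive_W_of_mem_interior hz).inner_left_eq_inner_right a b
  · refine ge_of_tendsto ((hlim a).inner (tendsto_const_nhds (x := a))) ?_
    filter_upwards [self_mem_nhdsWithin] with z hz
    exact (hφ.isPositive_W_of_mem_interior hz).inner_nonneg_left a

/-- The mean value theorem along the segment expresses the right-hand inner product by the Hessian
at some point `z`; Cauchy–Schwarz for `W z` bounds that Hessian form below. -/
theorem norm_sq_le_mul_inner_grad_sub {S : Set (E n)} (hS : Convex ℝ S) (hSX : S ⊆ interior X)
    {M : ℝ} (hM : ∀ y ∈ S, ‖W y‖ ≤ M) {a b : E n} (ha : a ∈ S) (hb : b ∈ S) :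
    ‖a - b‖ ^ 2 ≤ M * ⟪grad φ a - grad φ b, a - b⟫_ℝ := by
  have hmem : ∀ t ∈ Icc (0 : ℝ) 1, b + t • (a - b) ∈ S := fun t ht =>
    hS.add_smul_sub_mem hb ha ht
  have hd : ∀ t ∈ Icc (0 : ℝ) 1, HasDerivAt (fun t : ℝ => ⟪grad φ (b + t • (a - b)), a - b⟫_ℝ)
      ⟪hess φ (b + t • (a - b)) (a - b), a - b⟫_ℝ t := by
    intro t ht
    have h1 : HasDerivAt (fun t : ℝ => b + t • (a - b)) (a - b) t := by
      simpa using ((hasDerivAt_id t).smul_const (a - b)).const_add b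
    have h2 := (hφ.hasFDerivAt_grad (hSX (hmem t ht))).comp_hasDerivAt t h1
    simpa using h2.inner ℝ (hasDerivAt_const t (a - b))
  obtain ⟨t, ht, hte⟩ := exists_hasDerivAt_eq_slope _ _ zero_lt_one
    (fun t ht => (hd t ht).continuousAt.continuousWithinAt)
    (fun t ht => hd t (Ioo_subset_Icc_self ht))
  have hte' : ⟪hess φ (b + t • (a - b)) (a - b), a - b⟫_ℝ
      = ⟪grad φ a - grad φ b, a - b⟫_ℝ := by
    rw [hte, inner_sub_left]; simp
  have hz := hmem t (Ioo_subset_Icc_self ht)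
  have hp := norm_sq_le_of_isPositive (hφ.isPositive_W_of_mem_interior (hSX hz))
    (hess φ (b + t • (a - b)) (a - b))
  rw [hφ.W_hess (hSX hz), real_inner_comm, hte'] at hp
  refine hp.trans (mul_le_mul_of_nonneg_right (hM _ hz) ?_)
  exact hφ.inner_grad_sub_nonneg (hSX ha) (hSX hb)

theorem norm_sub_le_mul_norm_grad_sub {S : Set (E n)} (hS : Convex ℝ S) (hSX : S ⊆ interior X)
    {M : ℝ} (hM : ∀ y ∈ S, ‖W y‖ ≤ M) {a b : E n} (ha : a ∈ S) (hb : b ∈ S) :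
    ‖a - b‖ ≤ M * ‖grad φ a - grad φ b‖ := by
  have hM0 : 0 ≤ M := (norm_nonneg _).trans (hM a ha)
  have h := hφ.norm_sq_le_mul_inner_grad_sub hS hSX hM ha hb
  have h2 := mul_le_mul_of_nonneg_left (real_inner_le_norm (grad φ a - grad φ b) (a - b)) hM0
  rcases (norm_nonneg (a - b)).eq_or_lt with h0 | h0
  · rw [← h0]; positivity
  · refine le_of_mul_le_mul_right ?_ h0
    nlinarith

end secondOrder

end IsProjectiveBregmanKernel

/-! ### Solving for a prescribed gradient; projectivity of `W`; mirror and proximal steps. -/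

namespace IsProjectiveBregmanKernel

variable {n : ℕ} {X : Set (E n)} {φ : E n → EReal} {W : E n → E n →L[ℝ] E n}
  (hφ : IsProjectiveBregmanKernel X φ W)

include hφ

/-- `K ∩ interior X` need not be compact, but `φ = +∞` off the interior, so a minimiser over the
compact `K` avoids the boundary of `X`. -/
theorem exists_isMinOn_sub_inner {K : Set (E n)} (hK : IsCompact K) {y : E n} (hyK : y ∈ K)
    (hy : y ∈ interior X) (b : E n) :
    ∃ z ∈ K ∩ interior X, ∀ w ∈ K ∩ interior X,
      (φ z).toReal - ⟪b, z⟫_ℝ ≤ (φ w).toReal - ⟪b, w⟫_ℝ := by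
  have hlsc : LowerSemicontinuous fun w => φ w + ((-⟪b, w⟫_ℝ : ℝ) : EReal) := by
    refine hφ.lsc.add' (Continuous.lowerSemicontinuous ?_) fun w =>
      EReal.continuousAt_add (Or.inr (EReal.coe_ne_bot _)) (Or.inr (EReal.coe_ne_top _))
    exact continuous_coe_real_ereal.comp (by fun_prop)
  obtain ⟨z, hzK, hz⟩ := (hlsc.lowerSemicontinuousOn K).exists_isMinOn ⟨y, hyK⟩ hK
  have hcoe : ∀ w ∈ interior X, φ w + ((-⟪b, w⟫_ℝ : ℝ) : EReal)
      = (((φ w).toReal - ⟪b, w⟫_ℝ : ℝ) : EReal) := fun w hw => by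
    rw [← hφ.coe_toReal hw, ← EReal.coe_add, EReal.toReal_coe, sub_eq_add_neg]
  have hzX : z ∈ interior X := by
    by_contra hzX
    have h : φ z + ((-⟪b, z⟫_ℝ : ℝ) : EReal) ≤ φ y + ((-⟪b, y⟫_ℝ : ℝ) : EReal) := hz hyK
    rw [hφ.eq_top hzX, EReal.top_add_coe, hcoe y hy] at h
    exact EReal.coe_ne_top _ (top_le_iff.1 h)
  refine ⟨z, ⟨hzK, hzX⟩, fun w hw => ?_⟩
  have h : φ z + ((-⟪b, z⟫_ℝ : ℝ) : EReal) ≤ φ w + ((-⟪b, w⟫_ℝ : ℝ) : EReal) := hz hw.1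
  rw [hcoe z hzX, hcoe w hw.2] at h
  exact EReal.coe_le_coe_iff.1 h

theorem inner_grad_sub_le_of_isMin {S : Set (E n)} (hS : Convex ℝ S) {b y z : E n}
    (hz : z ∈ S) (hzX : z ∈ interior X) (hy : y ∈ S)
    (h : ∀ w ∈ S, (φ z).toReal - ⟪b, z⟫_ℝ ≤ (φ w).toReal - ⟪b, w⟫_ℝ) :
    ⟪grad φ z - b, z - y⟫_ℝ ≤ 0 := by
  have hlim := (hφ.hasDerivAt_line hzX (y - z)).tendsto_slope_zero_right
  have hge : ⟪b, y - z⟫_ℝ ≤ ⟪grad φ z, y - z⟫_ℝ := by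
    refine ge_of_tendsto hlim ?_
    filter_upwards [Ioc_mem_nhdsGT (zero_lt_one' ℝ)] with t ht
    have hw := h _ (hS.add_smul_sub_mem hz hy ⟨ht.1.le, ht.2⟩)
    rw [inner_add_right, inner_smul_right] at hw
    simp only [smul_eq_mul, zero_smul, add_zero, zero_add]
    rw [le_inv_mul_iff₀ ht.1]
    linarith
  rw [← neg_sub y z, inner_neg_right, inner_sub_left]
  linarith

/-- Minimise `φ - ⟪∇φ(y) + v, ·⟫` over the ball. Strong monotonicity keeps the minimiser within `M
‖v‖ < R` of `y`, so the ball constraint is inactive and the minimiser is a critical point. -/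
theorem exists_grad_eq (hX : Convex ℝ X) {y : E n} (hy : y ∈ interior X) {R M : ℝ}
    (hR : 0 ≤ R) (hM : ∀ z ∈ Metric.closedBall y R ∩ interior X, ‖W z‖ ≤ M) {v : E n} (hv : M * ‖v‖ < R) :
    ∃ z ∈ interior X, grad φ z = grad φ y + v ∧ ‖z - y‖ ≤ M * ‖v‖ := by
  set S := Metric.closedBall y R ∩ interior X with hSdef
  have hS : Convex ℝ S := (convex_closedBall y R).inter hX.interior
  have hyS : y ∈ S := ⟨Metric.mem_closedBall_self hR, hy⟩
  obtain ⟨z, hz, hmin⟩ := hφ.exists_isMinOn_sub_inner (isCompact_closedBall y R) hyS.1 hy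
    (grad φ y + v)
  have h1 := hφ.inner_grad_sub_le_of_isMin hS hz hz.2 hyS hmin
  have h2 := hφ.norm_sq_le_mul_inner_grad_sub hS inter_subset_right hM hz hyS
  have hM0 : 0 ≤ M := (norm_nonneg _).trans (hM y hyS)
  have h3 : ⟪grad φ z - grad φ y, z - y⟫_ℝ ≤ ‖v‖ * ‖z - y‖ := by
    rw [← sub_sub, inner_sub_left] at h1
    linarith [real_inner_le_norm v (z - y)]
  have hzy : ‖z - y‖ ≤ M * ‖v‖ := by
    rcases (norm_nonneg (z - y)).eq_or_lt with h0 | h0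
    · rw [← h0]; positivity
    · refine le_of_mul_le_mul_right ?_ h0
      nlinarith [mul_le_mul_of_nonneg_left h3 hM0]
  refine ⟨z, hz.2, hφ.grad_eq_of_eventually_le hz.2 ?_, hzy⟩
  have hball : z ∈ Metric.ball y R := by
    rw [mem_ball_iff_norm]; exact hzy.trans_lt hv
  filter_upwards [Metric.isOpen_ball.mem_nhds hball, isOpen_interior.mem_nhds hz.2] with w hw hwX
  exact hmin w ⟨Metric.ball_subset_closedBall hw, hwX⟩

/-- The preimages from `exists_grad_eq` form a Lipschitz local inverse `g` of `∇φ`, whose derivative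
is `W (g a)`. The mean value inequality for `g` minus the linear map `W y` gives the error, as `W (g
a)` is within `L M ‖v‖` of `W y`. -/
theorem exists_grad_eq_norm_sub_le (hX : Convex ℝ X) {y : E n} (hy : y ∈ interior X)
    {R M L : ℝ} (hM0 : 0 < M) (hL0 : 0 ≤ L)
    (hM : ∀ z ∈ Metric.closedBall y R ∩ interior X, ‖W z‖ ≤ M)
    (hL : ∀ z ∈ Metric.closedBall y R ∩ interior X, ‖W z - W y‖ ≤ L * ‖z - y‖)
    {v : E n} (hv : M * ‖v‖ < R) :
    ∃ z ∈ interior X, grad φ z = grad φ y + v ∧ ‖z - y - W y v‖ ≤ L * M * ‖v‖ ^ 2 := by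
  set S := Metric.closedBall y R ∩ interior X with hSdef
  have hS : Convex ℝ S := (convex_closedBall y R).inter hX.interior
  have hR : 0 ≤ R := (mul_nonneg hM0.le (norm_nonneg v)).trans hv.le
  have hex : ∀ a ∈ Metric.ball (grad φ y) (R / M), ∃ z ∈ interior X,
      grad φ z = a ∧ ‖z - y‖ ≤ M * ‖a - grad φ y‖ := by
    intro a ha
    rw [mem_ball_iff_norm, lt_div_iff₀' hM0] at ha
    obtain ⟨z, hz, hza, hzy⟩ := hφ.exists_grad_eq hX hy hR hM ha
    exact ⟨z, hz, by rw [hza, add_sub_cancel], hzy⟩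
  choose! g hgX hga hgy using hex
  have hgS : ∀ a ∈ Metric.ball (grad φ y) (R / M), g a ∈ S := by
    intro a ha
    refine ⟨mem_closedBall_iff_norm.2 ((hgy a ha).trans ?_), hgX a ha⟩
    rw [mem_ball_iff_norm, lt_div_iff₀' hM0] at ha
    exact ha.le
  have hlip : LipschitzOnWith ⟨M, hM0.le⟩ g (Metric.ball (grad φ y) (R / M)) := by
    refine LipschitzOnWith.of_dist_le_mul fun a ha b hb => ?_
    rw [dist_eq_norm, dist_eq_norm]
    have := hφ.norm_sub_le_mul_norm_grad_sub hS inter_subset_right hM (hgS a ha) (hgS b hb)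
    rwa [hga a ha, hga b hb] at this
  have hderiv : ∀ a ∈ Metric.ball (grad φ y) (R / M), HasFDerivAt g (W (g a)) a := by
    intro a ha
    have hnhds := Metric.isOpen_ball.mem_nhds ha
    obtain ⟨e, he⟩ := hφ.hess_invertible (g a) (hgX a ha)
    have hd : HasFDerivAt (grad φ) (e : E n →L[ℝ] E n) (g a) := by
      rw [he]; exact hφ.hasFDerivAt_grad (hgX a ha)
    have hW : W (g a) = (e.symm : E n →L[ℝ] E n) := by
      rw [hφ.W_eq _ (hgX a ha), ← he, ContinuousLinearMap.inverse_equiv]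
    rw [hW]
    exact HasFDerivAt.of_local_left_inverse (hlip.continuousOn.continuousAt hnhds) hd
      (by filter_upwards [hnhds] with b hb using hga b hb)
  have hsub : Metric.closedBall (grad φ y) ‖v‖ ⊆ Metric.ball (grad φ y) (R / M) :=
    Metric.closedBall_subset_ball ((lt_div_iff₀' hM0).2 hv)
  have h0 : grad φ y ∈ Metric.closedBall (grad φ y) ‖v‖ :=
    Metric.mem_closedBall_self (norm_nonneg v)
  have h1 : grad φ y + v ∈ Metric.closedBall (grad φ y) ‖v‖ := by
    rw [mem_closedBall_iff_norm, add_sub_cancel_left]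
  have hg0 : g (grad φ y) = y := by
    have := hgy _ (hsub h0)
    rw [sub_self, norm_zero, mul_zero] at this
    exact sub_eq_zero.1 (norm_le_zero_iff.1 this)
  have hbound : ∀ a ∈ Metric.closedBall (grad φ y) ‖v‖, ‖W (g a) - W y‖ ≤ L * (M * ‖v‖) := by
    intro a ha
    refine (hL _ (hgS a (hsub ha))).trans ?_
    gcongr
    refine (hgy a (hsub ha)).trans ?_
    gcongr
    exact mem_closedBall_iff_norm.1 ha
  have key := (convex_closedBall (grad φ y) ‖v‖).norm_image_sub_le_of_norm_hasFDerivWithin_le'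
    (fun a ha => (hderiv a (hsub ha)).hasFDerivWithinAt) hbound h0 h1
  rw [hg0, add_sub_cancel_left] at key
  refine ⟨g (grad φ y + v), hgX _ (hsub h1), hga _ (hsub h1), key.trans_eq (by ring)⟩

theorem exists_norm_le_and_lipschitz (hX : IsClosed X) (x : E n) (r : ℝ) :
    ∃ M L : ℝ, 0 < M ∧ 0 ≤ L ∧ (∀ y ∈ X ∩ Metric.closedBall x r, ‖W y‖ ≤ M) ∧
      ∀ y ∈ X ∩ Metric.closedBall x r, ∀ z ∈ X ∩ Metric.closedBall x r,
        ‖W y - W z‖ ≤ L * ‖y - z‖ := by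
  have hK : IsCompact (X ∩ Metric.closedBall x r) := (isCompact_closedBall x r).inter_left hX
  have hW : LocallyLipschitzOn (X ∩ Metric.closedBall x r) W :=
    hφ.W_locallyLipschitzOn.mono inter_subset_left
  obtain ⟨M, hM⟩ := hK.exists_bound_of_continuousOn hW.continuousOn
  obtain ⟨L, hL⟩ := hW.exists_lipschitzOnWith_of_compact hK
  refine ⟨max M 1, L, lt_max_of_lt_right one_pos, L.2, fun y hy => (hM y hy).trans
    (le_max_left _ _), fun y hy z hz => ?_⟩
  rw [← dist_eq_norm, ← dist_eq_norm]
  exact hL.dist_le_mul y hy z hz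

/-- For `M ‖v‖ < 1` the point with gradient `∇φ(y) + v` lies in `X` and is quadratically close to `y
+ W y v`. For larger `v` the point `y` itself serves, since `M ‖v‖ ≤ M² ‖v‖²`. Boundary points
follow by continuity, the slack in the radius leaving room for nearby interior points. -/
theorem exists_infDist_le (hXc : IsClosed X) (hX : Convex ℝ X) (r : ℝ) :
    ∃ B : ℝ, 0 ≤ B ∧ ∀ y ∈ X, ‖y‖ ≤ r → ∀ v : E n,
      Metric.infDist (y + W y v) X ≤ B * ‖v‖ ^ 2 := by
  obtain ⟨M, L, hM0, hL0, hM, hL⟩ := hφ.exists_norm_le_and_lipschitz hXc 0 (r + 2)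
  refine ⟨L * M + M ^ 2, by positivity, ?_⟩
  have hint : ∀ y ∈ interior X, ‖y‖ < r + 1 → ∀ v : E n,
      Metric.infDist (y + W y v) X ≤ (L * M + M ^ 2) * ‖v‖ ^ 2 := by
    intro y hy hyr v
    have hyX := interior_subset hy
    have hsub : Metric.closedBall y 1 ∩ interior X ⊆ X ∩ Metric.closedBall 0 (r + 2) := by
      rintro z ⟨hz, hzX⟩
      refine ⟨interior_subset hzX, mem_closedBall_zero_iff.2 ?_⟩
      have := norm_le_norm_add_norm_sub' z y
      have := mem_closedBall_iff_norm.1 hz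
      linarith
    have hyB : y ∈ X ∩ Metric.closedBall 0 (r + 2) :=
      hsub ⟨Metric.mem_closedBall_self zero_le_one, hy⟩
    rcases lt_or_ge (M * ‖v‖) 1 with h | h
    · obtain ⟨z, hz, -, hzy⟩ := hφ.exists_grad_eq_norm_sub_le hX hy hM0 hL0
        (fun z hz => hM z (hsub hz)) (fun z hz => hL z (hsub hz) y hyB) h
      refine (Metric.infDist_le_dist_of_mem (interior_subset hz)).trans ?_
      rw [dist_comm, dist_eq_norm, ← sub_sub]
      refine hzy.trans ?_
      gcongr
      nlinarith
    · refine (Metric.infDist_le_dist_of_mem hyX).trans ?_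
      rw [dist_eq_norm, add_sub_cancel_left]
      have h1 : ‖W y v‖ ≤ M * ‖v‖ :=
        ((W y).le_opNorm v).trans (mul_le_mul_of_nonneg_right (hM y hyB) (norm_nonneg v))
      have h2 : 0 ≤ L * M * ‖v‖ ^ 2 := by positivity
      nlinarith
  intro y hy hyr v
  have hne : (𝓝[interior X] y).NeBot :=
    mem_closure_iff_nhdsWithin_neBot.1 (hφ.mem_closure_interior hX hy)
  have hlim : Tendsto (fun z => Metric.infDist (z + W z v) X) (𝓝[interior X] y)
      (𝓝 (Metric.infDist (y + W y v) X)) := by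
    refine ((Metric.continuous_infDist_pt X).tendsto _).comp
      ((tendsto_id.mono_left nhdsWithin_le_nhds).add ?_)
    exact ((ContinuousLinearMap.apply ℝ (E n) v).continuous.tendsto _).comp
      ((hφ.W_locallyLipschitzOn.continuousOn y hy).mono_left
        (nhdsWithin_mono y interior_subset))
  refine le_of_tendsto hlim ?_
  have hnorm : ∀ᶠ z in 𝓝[interior X] y, ‖z‖ < r + 1 :=
    (continuous_norm.tendsto y).mono_left nhdsWithin_le_nhds
      |>.eventually (gt_mem_nhds (by linarith))
  filter_upwards [self_mem_nhdsWithin, hnorm] with z hz hzr using hint z hz hzr v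

theorem exists_isProjectiveMapping (hXc : IsClosed X) (hX : Convex ℝ X) :
    ∃ ρ : E n → ℝ, IsProjectiveMapping X W ρ := by
  choose B hB0 hB using fun k : ℕ => hφ.exists_infDist_le hXc hX k
  -- Summing all bounds up to `⌈‖y‖⌉` gives a majorant monotone in `‖y‖`, hence locally bounded,
  -- although the `B k` themselves need not be monotone.
  refine ⟨fun y => ∑ k ∈ Finset.range (⌈‖y‖⌉₊ + 1), B k, hφ.W_locallyLipschitzOn.continuousOn,
    fun y hy => hφ.isPositive_W hX hy, hφ.ker_W,
    fun y _ => Finset.sum_nonneg fun k _ => hB0 k, fun S _ hS => ?_, fun y hy v _ => ?_⟩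
  · obtain ⟨R, hR⟩ := hS.isBounded.exists_norm_le
    refine ⟨∑ k ∈ Finset.range (⌈R⌉₊ + 1), B k, fun y hy => ?_⟩
    rw [abs_of_nonneg (Finset.sum_nonneg fun k _ => hB0 k)]
    exact Finset.sum_le_sum_of_subset_of_nonneg
      (Finset.range_mono (Nat.succ_le_succ (Nat.ceil_mono (hR y hy)))) fun k _ _ => hB0 k
  · refine (hB ⌈‖y‖⌉₊ y hy (Nat.le_ceil _) v).trans ?_
    gcongr
    exact Finset.single_le_sum (fun k _ => hB0 k) (Finset.self_mem_range_succ _)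

theorem isMirrorStep_iff {d y z : E n} :
    IsMirrorStep φ d y z ↔ z ∈ interior X ∧ grad φ z = grad φ y - d := by
  rw [IsMirrorStep, hφ.lt_top_iff]

/-- Up to a constant the objective is `φ - ⟪∇φ(y) - d, ·⟫`. It is `+∞` off the interior, and convex
there, so its minimisers are exactly its critical points. -/
theorem isProxStep_iff {d y z : E n} (hy : y ∈ interior X) :
    IsProxStep φ d y z ↔ IsMirrorStep φ d y z := by
  have hcoe : ∀ w ∈ interior X, ((⟪w - y, d⟫_ℝ : ℝ) : EReal) + bregmanDiv φ w y
      = (((φ w).toReal - ⟪grad φ y - d, w⟫_ℝ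
        + (⟪grad φ y - d, y⟫_ℝ - (φ y).toReal) : ℝ) : EReal) := fun w hw => by
    rw [bregmanDiv, ← hφ.coe_toReal hw, ← hφ.coe_toReal hy, ← EReal.coe_sub, ← EReal.coe_sub,
      ← EReal.coe_add, EReal.toReal_coe, EReal.toReal_coe, EReal.coe_eq_coe_iff]
    rw [real_inner_comm, ← sub_eq_zero]
    simp only [inner_sub_left, inner_sub_right]
    ring
  have htop : ∀ w, w ∉ interior X →
      ((⟪w - y, d⟫_ℝ : ℝ) : EReal) + bregmanDiv φ w y = ⊤ := fun w hw => by
    rw [bregmanDiv, hφ.eq_top hw, ← hφ.coe_toReal hy, EReal.top_sub_coe, EReal.top_sub_coe,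
      EReal.coe_add_top]
  rw [hφ.isMirrorStep_iff]
  constructor
  · intro h
    have h' : ∀ w, ((⟪z - y, d⟫_ℝ : ℝ) : EReal) + bregmanDiv φ z y ≤
        ((⟪w - y, d⟫_ℝ : ℝ) : EReal) + bregmanDiv φ w y := fun w => h (mem_univ w)
    have hz : z ∈ interior X := by
      by_contra hz
      have := h' y
      rw [htop z hz, hcoe y hy] at this
      exact EReal.coe_ne_top _ (top_le_iff.1 this)
    refine ⟨hz, hφ.grad_eq_of_eventually_le hz ?_⟩
    filter_upwards [isOpen_interior.mem_nhds hz] with w hw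
    have := h' w
    rw [hcoe z hz, hcoe w hw, EReal.coe_le_coe_iff] at this
    linarith
  · rintro ⟨hz, hzy⟩ w -
    change ((⟪z - y, d⟫_ℝ : ℝ) : EReal) + bregmanDiv φ z y ≤
        ((⟪w - y, d⟫_ℝ : ℝ) : EReal) + bregmanDiv φ w y
    by_cases hw : w ∈ interior X
    · rw [hcoe z hz, hcoe w hw, EReal.coe_le_coe_iff, ← hzy]
      have := hφ.add_inner_grad_le hw hz
      rw [inner_sub_right] at this
      linarith
    · rw [htop w hw]; exact le_top

theorem isMirrorStep_unique {d y z z' : E n} (hz : IsMirrorStep φ d y z)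
    (hz' : IsMirrorStep φ d y z') : z = z' := by
  rw [hφ.isMirrorStep_iff] at hz hz'
  exact hφ.injOn_grad hz.1 hz'.1 (hz.2.trans hz'.2.symm)

end IsProjectiveBregmanKernel

/-! ### Estimates for one step of the iteration. -/

section

variable {n p : ℕ}

/-- Comparing with a primitive of `L ‖z - y‖² t`, instead of bounding the derivative by a constant,
produces the factor `1/2`. -/
theorem norm_sub_sub_fderiv_le {c : E n → E p} (hc : Differentiable ℝ c) {y z : E n} {L : ℝ}
    (hL : ∀ t ∈ Icc (0 : ℝ) 1,
      ‖fderiv ℝ c (y + t • (z - y)) - fderiv ℝ c y‖ ≤ L * ‖t • (z - y)‖) :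
    ‖c z - c y - fderiv ℝ c y (z - y)‖ ≤ L / 2 * ‖z - y‖ ^ 2 := by
  have hf : ∀ t : ℝ, HasDerivAt
      (fun t : ℝ => c (y + t • (z - y)) - c y - t • fderiv ℝ c y (z - y))
      (fderiv ℝ c (y + t • (z - y)) (z - y) - fderiv ℝ c y (z - y)) t := by
    intro t
    have h1 : HasDerivAt (fun t : ℝ => y + t • (z - y)) (z - y) t := by
      simpa using ((hasDerivAt_id t).smul_const (z - y)).const_add y
    have h2 := (hc (y + t • (z - y))).hasFDerivAt.comp_hasDerivAt t h1
    have h3 := (hasDerivAt_id t).smul_const (fderiv ℝ c y (z - y))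
    rw [one_smul] at h3
    exact (h2.sub_const (c y)).sub h3
  have hB : ∀ t : ℝ, HasDerivAt (fun t : ℝ => L * ‖z - y‖ ^ 2 / 2 * t ^ 2)
      (L * ‖z - y‖ ^ 2 * t) t := by
    intro t
    exact ((hasDerivAt_pow 2 t).const_mul (L * ‖z - y‖ ^ 2 / 2)).congr_deriv
      (by push_cast; ring)
  have key := image_norm_le_of_norm_deriv_right_le_deriv_boundary (a := 0) (b := 1)
    (fun t _ => (hf t).continuousAt.continuousWithinAt)
    (fun t _ => (hf t).hasDerivWithinAt) (by simp) hB (fun t ht => by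
      rw [← sub_apply]
      refine (ContinuousLinearMap.le_opNorm _ _).trans ?_
      refine (mul_le_mul_of_nonneg_right (hL t (Ico_subset_Icc_self ht))
        (norm_nonneg _)).trans_eq ?_
      rw [norm_smul, Real.norm_of_nonneg ht.1]
      ring) (right_mem_Icc.2 zero_le_one)
  simp only [one_smul, add_sub_cancel] at key
  exact key.trans_eq (by ring)

/-- The multiplier `(∇c(y)ᵀ Q(y) ∇c(y) + τ(‖c(y)‖) I)⁻¹ c(y)`. -/
noncomputable def multiplier (c : E n → E p) (W : E n → E n →L[ℝ] E n) (τ : ℝ≥0 → ℝ≥0)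
    (y : E n) : E p :=
  (gram c W y + (τ ‖c y‖₊ : ℝ) • ContinuousLinearMap.id ℝ (E p)).inverse (c y)

/-- Bounds near `x` under which one step of the iteration contracts the constraint violation. -/
structure LocalBounds (X : Set (E n)) (c : E n → E p) (W : E n → E n →L[ℝ] E n) (τ : ℝ≥0 → ℝ≥0)
    (x : E n) (γ M N K L T σ δ : ℝ) : Prop where
  differentiable : Differentiable ℝ c
  apply_eq_zero : c x = 0
  isPositive : ∀ y ∈ X, (W y).IsPositive
  τ_le : ∀ t : ℝ≥0, t ≤ 1 → (τ t : ℝ) ≤ T * t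
  M_pos : 0 < M
  N_pos : 0 < N
  K_nonneg : 0 ≤ K
  L_nonneg : 0 ≤ L
  T_pos : 0 < T
  σ_pos : 0 < σ
  δ_pos : 0 < δ
  gram_le : ∀ y ∈ X ∩ Metric.closedBall x δ, ∀ q, σ / 2 * ‖q‖ ≤ ‖gram c W y q‖
  nablac_le : ∀ y ∈ Metric.closedBall x γ, ‖nablac c y‖ ≤ M
  W_le : ∀ y ∈ Metric.closedBall x γ ∩ X, ‖W y‖ ≤ N
  nablac_sub_le : ∀ y ∈ Metric.closedBall x γ, ∀ z ∈ Metric.closedBall x γ,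
    ‖nablac c y - nablac c z‖ ≤ L * ‖y - z‖
  two_mul_δ_le : 2 * δ ≤ γ
  δ_mul_M_le : δ * M ≤ 1
  δ_mul_add_le : δ * (σ + 4 * N * M ^ 2) ≤ γ * σ
  δ_mul_K_le : δ * K * σ ≤ N
  δ_mul_sum_le : δ * ((2 * T * σ + 2 * L * N ^ 2 * M ^ 2 + 2 * σ ^ 2 * M * K) * (2 * M)) ≤ σ ^ 2

namespace LocalBounds

variable {X : Set (E n)} {c : E n → E p} {W : E n → E n →L[ℝ] E n} {τ : ℝ≥0 → ℝ≥0}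
  {x : E n} {γ M N K L T σ δ : ℝ} (h : LocalBounds X c W τ x γ M N K L T σ δ)

include h

theorem closedBall_subset : Metric.closedBall x δ ⊆ Metric.closedBall x γ :=
  Metric.closedBall_subset_closedBall (by linarith [h.two_mul_δ_le, h.δ_pos])

theorem γ_nonneg : 0 ≤ γ := by linarith [h.two_mul_δ_le, h.δ_pos]

theorem norm_sub_le {y z : E n} (hy : y ∈ Metric.closedBall x γ)
    (hz : z ∈ Metric.closedBall x γ) : ‖c z - c y‖ ≤ M * ‖z - y‖ :=
  (convex_closedBall x γ).norm_image_sub_le_of_norm_fderiv_le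
    (fun w _ => h.differentiable w) (fun w hw => by rw [← norm_nablac]; exact h.nablac_le w hw)
    hy hz

theorem norm_apply_le {y : E n} (hy : y ∈ Metric.closedBall x γ) : ‖c y‖ ≤ M * ‖y - x‖ := by
  simpa [h.apply_eq_zero] using h.norm_sub_le (Metric.mem_closedBall_self h.γ_nonneg) hy

theorem norm_apply_le_mul_δ {y : E n} (hy : y ∈ Metric.closedBall x δ) : ‖c y‖ ≤ M * δ :=
  (h.norm_apply_le (h.closedBall_subset hy)).trans
    (mul_le_mul_of_nonneg_left (mem_closedBall_iff_norm.1 hy) h.M_pos.le)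

theorem norm_taylor_le {y z : E n} (hy : y ∈ Metric.closedBall x γ)
    (hz : z ∈ Metric.closedBall x γ) :
    ‖c z - c y - fderiv ℝ c y (z - y)‖ ≤ L / 2 * ‖z - y‖ ^ 2 := by
  refine norm_sub_sub_fderiv_le h.differentiable fun t ht => ?_
  have hw := (convex_closedBall x γ).add_smul_sub_mem hy hz ht
  have := h.nablac_sub_le _ hw _ hy
  rw [add_sub_cancel_left, nablac, nablac, ← map_sub, LinearIsometryEquiv.norm_map] at this
  exact this

theorem norm_multiplier_le {y : E n} (hy : y ∈ X ∩ Metric.closedBall x δ) :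
    ‖multiplier c W τ y‖ ≤ 2 / σ * ‖c y‖ := by
  have := mul_norm_inverse_add_smul_id_le (isPositive_gram (c := c) (h.isPositive y hy.1))
    (half_pos h.σ_pos) (h.gram_le y hy) (τ ‖c y‖₊).coe_nonneg (c y)
  have hσ := h.σ_pos
  rw [div_mul_eq_mul_div, le_div_iff₀ hσ]
  change σ / 2 * ‖multiplier c W τ y‖ ≤ ‖c y‖ at this
  linarith

theorem gram_multiplier {y : E n} (hy : y ∈ X ∩ Metric.closedBall x δ) :
    gram c W y (multiplier c W τ y) + (τ ‖c y‖₊ : ℝ) • multiplier c W τ y = c y :=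
  (isInvertible_add_smul_id (isPositive_gram (c := c) (h.isPositive y hy.1))
    (half_pos h.σ_pos) (h.gram_le y hy) (τ ‖c y‖₊).coe_nonneg).self_apply_inverse (c y)

theorem norm_dir_le {y : E n} (hy : y ∈ X ∩ Metric.closedBall x δ) :
    ‖dir c W τ y‖ ≤ 2 * M / σ * ‖c y‖ := by
  have hσ := h.σ_pos
  have hM := h.M_pos
  calc ‖dir c W τ y‖ ≤ ‖nablac c y‖ * ‖multiplier c W τ y‖ := ContinuousLinearMap.le_opNorm _ _
    _ ≤ M * (2 / σ * ‖c y‖) := by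
        gcongr
        · exact h.nablac_le y (h.closedBall_subset hy.2)
        · exact h.norm_multiplier_le hy
    _ = 2 * M / σ * ‖c y‖ := by ring

theorem norm_dissolve_sub_le {y : E n} (hy : y ∈ X ∩ Metric.closedBall x δ) :
    ‖dissolve c W τ y - y‖ ≤ 2 * N * M / σ * ‖c y‖ := by
  have hσ := h.σ_pos
  have hN := h.N_pos
  rw [dissolve, sub_sub_cancel_left, norm_neg]
  calc ‖W y (dir c W τ y)‖ ≤ ‖W y‖ * ‖dir c W τ y‖ := ContinuousLinearMap.le_opNorm _ _
    _ ≤ N * (2 * M / σ * ‖c y‖) := by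
        gcongr
        · exact h.W_le y ⟨h.closedBall_subset hy.2, hy.1⟩
        · exact h.norm_dir_le hy
    _ = 2 * N * M / σ * ‖c y‖ := by ring

/-- The added term is twice the bound on the `dissolve` displacement; it also bounds the perturbed
step, so both endpoints stay where the constants are valid. -/
theorem add_mul_norm_apply_le {y : E n} (hy : y ∈ Metric.closedBall x δ) :
    δ + 4 * N * M / σ * ‖c y‖ ≤ γ := by
  have hσ := h.σ_pos
  have hN := h.N_pos
  have hM := h.M_pos
  have h1 := h.norm_apply_le_mul_δ hy
  have h2 : 4 * N * M / σ * ‖c y‖ ≤ 4 * N * M / σ * (M * δ) := by gcongr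
  have h3 : 4 * N * M / σ * (M * δ) = δ * (4 * N * M ^ 2) / σ := by ring
  have h4 : δ * (4 * N * M ^ 2) / σ ≤ γ - δ := by
    rw [div_le_iff₀ hσ]
    linarith [h.δ_mul_add_le]
  linarith

theorem dissolve_mem {y : E n} (hy : y ∈ X ∩ Metric.closedBall x δ) :
    dissolve c W τ y ∈ Metric.closedBall x γ := by
  have hσ := h.σ_pos
  have hN := h.N_pos
  have hM := h.M_pos
  have h1 := h.norm_dissolve_sub_le hy
  have h2 := h.add_mul_norm_apply_le hy.2
  have h3 := norm_sub_le_norm_sub_add_norm_sub (dissolve c W τ y) y x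
  have h4 := mem_closedBall_iff_norm.1 hy.2
  have h5 : 0 ≤ 2 * N * M / σ * ‖c y‖ := by positivity
  have h6 : 4 * N * M / σ * ‖c y‖ = 2 * (2 * N * M / σ * ‖c y‖) := by ring
  rw [mem_closedBall_iff_norm]
  linarith

/-- The linearised constraint cancels up to the regularisation term `hlin`. The linear bound on `τ`
applies since `δ M ≤ 1` forces `‖c y‖ ≤ 1`. -/
theorem norm_apply_dissolve_le {y : E n} (hy : y ∈ X ∩ Metric.closedBall x δ) :
    ‖c (dissolve c W τ y)‖ ≤ (2 * T / σ + 2 * L * N ^ 2 * M ^ 2 / σ ^ 2) * ‖c y‖ ^ 2 := by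
  have hσ := h.σ_pos
  have hN := h.N_pos
  have hM := h.M_pos
  have hT := h.T_pos
  have hL := h.L_nonneg
  have hlin : c y + fderiv ℝ c y (dissolve c W τ y - y)
      = (τ ‖c y‖₊ : ℝ) • multiplier c W τ y := by
    have hd : fderiv ℝ c y (W y (dir c W τ y)) = gram c W y (multiplier c W τ y) := rfl
    rw [dissolve, sub_sub_cancel_left, map_neg, hd, ← sub_eq_add_neg, sub_eq_iff_eq_add']
    exact (h.gram_multiplier hy).symm
  have hτ : ‖(τ ‖c y‖₊ : ℝ) • multiplier c W τ y‖ ≤ 2 * T / σ * ‖c y‖ ^ 2 := by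
    have h1 : (τ ‖c y‖₊ : ℝ) ≤ T * ‖c y‖ := by
      refine h.τ_le _ (NNReal.coe_le_coe.1 ?_)
      rw [coe_nnnorm, NNReal.coe_one]
      exact (h.norm_apply_le_mul_δ hy.2).trans (by linarith [h.δ_mul_M_le])
    rw [norm_smul, Real.norm_of_nonneg (NNReal.coe_nonneg _)]
    calc (τ ‖c y‖₊ : ℝ) * ‖multiplier c W τ y‖ ≤ (T * ‖c y‖) * (2 / σ * ‖c y‖) := by
          gcongr
          exact h.norm_multiplier_le hy
      _ = 2 * T / σ * ‖c y‖ ^ 2 := by ring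
  have htaylor : ‖c (dissolve c W τ y) - c y - fderiv ℝ c y (dissolve c W τ y - y)‖
      ≤ 2 * L * N ^ 2 * M ^ 2 / σ ^ 2 * ‖c y‖ ^ 2 := by
    refine (h.norm_taylor_le (h.closedBall_subset hy.2) (h.dissolve_mem hy)).trans ?_
    calc L / 2 * ‖dissolve c W τ y - y‖ ^ 2 ≤ L / 2 * (2 * N * M / σ * ‖c y‖) ^ 2 := by
          gcongr
          exact h.norm_dissolve_sub_le hy
      _ = 2 * L * N ^ 2 * M ^ 2 / σ ^ 2 * ‖c y‖ ^ 2 := by ring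
  rw [sub_sub, hlin] at htaylor
  have := norm_add_le (c (dissolve c W τ y) - (τ ‖c y‖₊ : ℝ) • multiplier c W τ y)
    ((τ ‖c y‖₊ : ℝ) • multiplier c W τ y)
  rw [sub_add_cancel] at this
  linarith

/-- On the `δ`-ball the quadratic error is at most the bound on the `dissolve` displacement, so a
perturbed step is at most twice as long. -/
theorem error_le {y z : E n} (hy : y ∈ X ∩ Metric.closedBall x δ)
    (hz : ‖dissolve c W τ y - z‖ ≤ K * ‖c y‖ ^ 2) :
    ‖dissolve c W τ y - z‖ ≤ 2 * N * M / σ * ‖c y‖ := by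
  have hσ := h.σ_pos
  have hN := h.N_pos
  have hM := h.M_pos
  have hK := h.K_nonneg
  have h1 : K * ‖c y‖ ≤ 2 * N * M / σ := by
    have h2 : K * ‖c y‖ ≤ K * (M * δ) := by gcongr; exact h.norm_apply_le_mul_δ hy.2
    refine h2.trans ?_
    rw [le_div_iff₀ hσ]
    nlinarith [mul_le_mul_of_nonneg_left h.δ_mul_K_le hM.le, mul_pos hN hM]
  refine hz.trans ?_
  rw [pow_two, ← mul_assoc]
  gcongr

theorem norm_step_sub_le {y z : E n} (hy : y ∈ X ∩ Metric.closedBall x δ)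
    (hz : ‖dissolve c W τ y - z‖ ≤ K * ‖c y‖ ^ 2) :
    ‖z - y‖ ≤ 4 * N * M / σ * ‖c y‖ := by
  have h1 := h.error_le hy hz
  have h2 := h.norm_dissolve_sub_le hy
  have h3 := norm_sub_le_norm_sub_add_norm_sub z (dissolve c W τ y) y
  rw [norm_sub_rev z (dissolve c W τ y)] at h3
  have h4 : 4 * N * M / σ * ‖c y‖ = 2 * (2 * N * M / σ * ‖c y‖) := by ring
  linarith

theorem norm_apply_step_le {y z : E n} (hy : y ∈ X ∩ Metric.closedBall x δ)
    (hz : ‖dissolve c W τ y - z‖ ≤ K * ‖c y‖ ^ 2) :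
    ‖c z‖ ≤ (2 * T / σ + 2 * L * N ^ 2 * M ^ 2 / σ ^ 2 + M * K) * ‖c y‖ ^ 2 := by
  have hzγ : z ∈ Metric.closedBall x γ := by
    have h1 := h.norm_step_sub_le hy hz
    have h2 := h.add_mul_norm_apply_le hy.2
    have h3 := norm_sub_le_norm_sub_add_norm_sub z y x
    have h4 := mem_closedBall_iff_norm.1 hy.2
    rw [mem_closedBall_iff_norm]
    linarith
  have h1 := h.norm_sub_le hzγ (h.dissolve_mem hy)
  have h2 := mul_le_mul_of_nonneg_left hz h.M_pos.le
  have h3 := h.norm_apply_dissolve_le hy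
  have h4 := norm_sub_norm_le (c z) (c (dissolve c W τ y))
  rw [norm_sub_rev] at h4
  linarith

theorem norm_apply_step_le_half {y z : E n} (hy : y ∈ X ∩ Metric.closedBall x δ)
    (hz : ‖dissolve c W τ y - z‖ ≤ K * ‖c y‖ ^ 2) : ‖c z‖ ≤ ‖c y‖ / 2 := by
  have hσ := h.σ_pos
  have hN := h.N_pos
  have hM := h.M_pos
  have hT := h.T_pos
  have hL := h.L_nonneg
  have hK := h.K_nonneg
  have hδ := h.δ_pos
  have h1 : (2 * T / σ + 2 * L * N ^ 2 * M ^ 2 / σ ^ 2 + M * K) * ‖c y‖ ≤ 1 / 2 := by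
    calc (2 * T / σ + 2 * L * N ^ 2 * M ^ 2 / σ ^ 2 + M * K) * ‖c y‖
        ≤ (2 * T / σ + 2 * L * N ^ 2 * M ^ 2 / σ ^ 2 + M * K) * (M * δ) := by
          gcongr; exact h.norm_apply_le_mul_δ hy.2
      _ = (2 * T * σ + 2 * L * N ^ 2 * M ^ 2 + σ ^ 2 * M * K) * (M * δ) / σ ^ 2 := by
          field_simp
      _ ≤ 1 / 2 := by
          rw [div_le_iff₀ (by positivity)]
          have : 0 ≤ σ ^ 2 * M * K * (M * δ) := by positivity
          linarith [h.δ_mul_sum_le]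
  refine (h.norm_apply_step_le hy hz).trans ?_
  have h2 := mul_le_mul_of_nonneg_right h1 (norm_nonneg (c y))
  linarith

end LocalBounds

end

/-! ### The constants attached to `x`: positivity and the inequalities built into `δ`. -/

section quotient

theorem quot_pos {a b : ℝ} (ha : 0 < a) : 0 < quot a b :=
  ENNReal.div_pos (ENNReal.ofReal_pos.2 ha).ne' ENNReal.ofReal_ne_top

theorem toReal_mul_le_of_le_quot {D : ℝ≥0∞} {a b : ℝ} (ha : 0 ≤ a)
    (h : D ≤ quot a b) : D.toReal * b ≤ a := by
  rcases le_or_gt b 0 with hb | hb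
  · exact (mul_nonpos_of_nonneg_of_nonpos ENNReal.toReal_nonneg hb).trans ha
  · rw [quot, ENNReal.le_div_iff_mul_le (Or.inl (ENNReal.ofReal_pos.2 hb).ne')
      (Or.inl ENNReal.ofReal_ne_top)] at h
    have := ENNReal.toReal_mono ENNReal.ofReal_ne_top h
    rwa [ENNReal.toReal_mul, ENNReal.toReal_ofReal hb.le, ENNReal.toReal_ofReal ha] at this

end quotient

section constants

variable {n p : ℕ} {X : Set (E n)} {c : E n → E p} {W : E n → E n →L[ℝ] E n}
  {ρ ξ : E n → ℝ} {Lτ : ℝ} {x : E n}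

theorem continuous_nablac (hc : IsConstraintMap c) : Continuous (nablac c) :=
  (ContinuousLinearMap.adjoint (𝕜 := ℝ) (E := E n) (F := E p)).continuous.comp
    hc.locallyLipschitz_fderiv.continuous

theorem continuousOn_gram (hc : IsConstraintMap c) (hW : ContinuousOn W X) :
    ContinuousOn (gram c W) X :=
  hc.locallyLipschitz_fderiv.continuous.continuousOn.clm_comp
    (hW.clm_comp (continuous_nablac hc).continuousOn)

theorem gam_bddAbove : BddAbove {γ | 0 < γ ∧ γ ≤ 1 ∧
    ∀ y ∈ Metric.closedBall x γ ∩ X, sigmaQ c W x / 2 ≤ sigmaMin (gram c W y)} :=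
  ⟨1, fun _ h => h.2.1⟩

theorem gam_pos (hp : 0 < p) (hc : IsConstraintMap c) (hW : ContinuousOn W X) (hx : x ∈ X)
    (hσ : 0 < sigmaQ c W x) : 0 < gam X c W x := by
  have hcont : ContinuousWithinAt (fun y => sigmaMin (gram c W y)) X x :=
    ((continuous_sigmaMin hp).continuousAt).comp_continuousWithinAt
      (continuousOn_gram hc hW x hx)
  have hev : ∀ᶠ y in 𝓝[X] x, sigmaQ c W x / 2 < sigmaMin (gram c W y) :=
    hcont.eventually (lt_mem_nhds (half_lt_self hσ))
  obtain ⟨ε, hε, hsub⟩ := Metric.mem_nhdsWithin_iff.1 hev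
  refine lt_of_lt_of_le (lt_min (half_pos hε) one_pos)
    (le_csSup gam_bddAbove ⟨lt_min (half_pos hε) one_pos, min_le_right _ _, fun y hy => ?_⟩)
  refine (hsub ⟨Metric.closedBall_subset_ball ?_ hy.1, hy.2⟩ : _ < _).le
  exact (min_le_left _ _).trans_lt (half_lt_self hε)

theorem gam_le_one (hγ : 0 < gam X c W x) : gam X c W x ≤ 1 := by
  refine csSup_le ?_ fun _ h => h.2.1
  by_contra hne
  rw [not_nonempty_iff_eq_empty] at hne
  rw [gam, hne, Real.sSup_empty] at hγ
  exact lt_irrefl _ hγ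

/-- The supremum defining `gam` is not shown to be attained, hence the strict inequality; `2 δ ≤ γ`
makes it hold on the `δ`-ball. -/
theorem sigmaQ_div_two_le (hγ : 0 < gam X c W x) {y : E n} (hy : y ∈ X)
    (hyx : ‖y - x‖ < gam X c W x) : sigmaQ c W x / 2 ≤ sigmaMin (gram c W y) := by
  have hne : {γ | 0 < γ ∧ γ ≤ 1 ∧
      ∀ y ∈ Metric.closedBall x γ ∩ X, sigmaQ c W x / 2 ≤ sigmaMin (gram c W y)}.Nonempty := by
    by_contra hne
    rw [not_nonempty_iff_eq_empty] at hne
    rw [gam, hne, Real.sSup_empty] at hγ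
    exact lt_irrefl _ hγ
  obtain ⟨γ, hγ', hlt⟩ := exists_lt_of_lt_csSup hne hyx
  exact hγ'.2.2 y ⟨mem_closedBall_iff_norm.2 hlt.le, hy⟩

theorem norm_nablac_le_Mc (hc : IsConstraintMap c) {y : E n} (hy : y ∈ ballx X c W x) :
    ‖nablac c y‖ ≤ Mc X c W x :=
  le_csSup ((isCompact_closedBall x _).image (continuous_nablac hc).norm).bddAbove
    (mem_image_of_mem _ hy)

theorem norm_le_MQ (hXc : IsClosed X) (hW : ContinuousOn W X) {y : E n}
    (hy : y ∈ ballx X c W x ∩ X) : ‖W y‖ ≤ MQ X c W x :=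
  le_csSup (((isCompact_closedBall x _).inter_right hXc).image_of_continuousOn
    (hW.mono inter_subset_right).norm).bddAbove (mem_image_of_mem _ hy)

theorem norm_nablac_sub_le_Lc (hc : IsConstraintMap c) {y z : E n}
    (hy : y ∈ ballx X c W x) (hz : z ∈ ballx X c W x) :
    ‖nablac c y - nablac c z‖ ≤ Lc X c W x * ‖y - z‖ := by
  have hsub : ∀ a b, ‖nablac c a - nablac c b‖ = ‖fderiv ℝ c a - fderiv ℝ c b‖ := fun a b => by
    rw [nablac, nablac, ← map_sub, LinearIsometryEquiv.norm_map]
  obtain ⟨K, hK⟩ := (hc.locallyLipschitz_fderiv.locallyLipschitzOn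
    (s := ballx X c W x)).exists_lipschitzOnWith_of_compact (isCompact_closedBall x _)
  rcases eq_or_ne y z with rfl | hne
  · simp
  rw [← div_le_iff₀ (norm_pos_iff.2 (sub_ne_zero.2 hne))]
  refine le_csSup ⟨K, ?_⟩ ⟨y, hy, z, hz, hne, rfl⟩
  rintro _ ⟨a, ha, b, hb, hab, rfl⟩
  rw [div_le_iff₀ (norm_pos_iff.2 (sub_ne_zero.2 hab)), hsub]
  simpa [dist_eq_norm] using hK.dist_le_mul a ha b hb

theorem Lc_nonneg : 0 ≤ Lc X c W x :=
  Real.sSup_nonneg (by rintro _ ⟨a, -, b, -, -, rfl⟩; positivity)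

theorem Lrho_nonneg (hρ : ∀ y ∈ X, 0 ≤ ρ y) : 0 ≤ Lrho X c W ρ x :=
  Real.sSup_nonneg (by rintro _ ⟨a, ha, rfl⟩; exact hρ a ha.2)

theorem Mxi_nonneg (hξ : ∀ y, 0 ≤ ξ y) : 0 ≤ Mxi X c W ξ x :=
  Real.sSup_nonneg (by rintro _ ⟨a, -, rfl⟩; exact hξ a)

theorem le_Mxi (hξ : LocallyBoundedOn univ ξ) {y : E n} (hy : y ∈ ballx X c W x) :
    ξ y ≤ Mxi X c W ξ x := by
  obtain ⟨B, hB⟩ := hξ _ (subset_univ _) (isCompact_closedBall x (gam X c W x))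
  refine le_csSup ⟨B, ?_⟩ (mem_image_of_mem _ hy)
  rintro _ ⟨a, ha, rfl⟩
  exact (le_abs_self _).trans (hB a ha)

theorem mem_ballx_self (hγ : 0 < gam X c W x) : x ∈ ballx X c W x :=
  Metric.mem_closedBall_self hγ.le

theorem Mc_pos (hp : 0 < p) (hc : IsConstraintMap c) (hγ : 0 < gam X c W x)
    (hσ : 0 < sigmac c x) : 0 < Mc X c W x :=
  hσ.trans_le ((sigmaMin_le_opNorm hp _).trans (norm_nablac_le_Mc hc (mem_ballx_self hγ)))

theorem MQ_pos (hp : 0 < p) (hXc : IsClosed X) (hW : ContinuousOn W X) (hx : x ∈ X)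
    (hγ : 0 < gam X c W x) (hσ : 0 < sigmaQ c W x) : 0 < MQ X c W x := by
  refine lt_of_lt_of_le (norm_pos_iff.2 fun h => ?_)
    (norm_le_MQ hXc hW ⟨mem_ballx_self hγ, hx⟩)
  have h0 : gram c W x = 0 := by rw [gram, h]; simp
  have := sigmaMin_le_opNorm hp (gram c W x)
  rw [h0, norm_zero, ← h0] at this
  exact hσ.not_ge this

theorem del_spec (hγ : 0 < gam X c W x) (hσc : 0 < sigmac c x) (hσ : 0 < sigmaQ c W x)
    (hMQ : 0 < MQ X c W x) :
    0 < del X c W ρ ξ Lτ x ∧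
    del X c W ρ ξ Lτ x * 2 ≤ gam X c W x ∧
    del X c W ρ ξ Lτ x * Mc X c W x ≤ 1 ∧
    del X c W ρ ξ Lτ x * (sigmaQ c W x + 4 * MQ X c W x * Mc X c W x ^ 2)
      ≤ gam X c W x * sigmaQ c W x ∧
    del X c W ρ ξ Lτ x *
      (4 * Lrho X c W ρ x * Mc X c W x ^ 2 + Mxi X c W ξ x * sigmaQ c W x ^ 2)
      ≤ MQ X c W x * sigmaQ c W x ∧
    del X c W ρ ξ Lτ x *
      ((12 * Lrho X c W ρ x * Mc X c W x ^ 3 + 2 * Lτ * sigmaQ c W x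
        + 2 * Lc X c W x * MQ X c W x ^ 2 * Mc X c W x ^ 2
        + 2 * sigmaQ c W x ^ 2 * Mc X c W x * Mxi X c W ξ x) * (2 * Mc X c W x))
      ≤ sigmaQ c W x ^ 2 := by
  rw [del]
  set D := quot (gam X c W x) 2 ⊓
    quot 1 (Mc X c W x) ⊓
    quot (sigmac c x) (6 * Lc X c W x) ⊓
    quot (sigmaQ c W x) (2 * Mc X c W x ^ 2) ⊓
    quot (gam X c W x * sigmaQ c W x)
      (sigmaQ c W x + 4 * MQ X c W x * Mc X c W x ^ 2) ⊓
    quot (MQ X c W x * sigmaQ c W x)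
      (4 * Lrho X c W ρ x * Mc X c W x ^ 2 + Mxi X c W ξ x * sigmaQ c W x ^ 2) ⊓
    quot (sigmaQ c W x ^ 2)
      ((12 * Lrho X c W ρ x * Mc X c W x ^ 3 + 2 * Lτ * sigmaQ c W x
        + 2 * Lc X c W x * MQ X c W x ^ 2 * Mc X c W x ^ 2
        + 2 * sigmaQ c W x ^ 2 * Mc X c W x * Mxi X c W ξ x) * (2 * Mc X c W x)) with hD
  have hpos : 0 < D := by
    simp only [hD, lt_inf_iff]
    exact ⟨⟨⟨⟨⟨⟨quot_pos hγ, quot_pos one_pos⟩, quot_pos hσc⟩, quot_pos hσ⟩,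
      quot_pos (mul_pos hγ hσ)⟩, quot_pos (mul_pos hMQ hσ)⟩, quot_pos (pow_pos hσ 2)⟩
  obtain ⟨⟨⟨⟨⟨⟨h1, h2⟩, -⟩, -⟩, h3⟩, h4⟩, h5⟩ := by
    have := le_of_eq hD
    simpa only [le_inf_iff] using this
  -- Finiteness matters because `toReal` sends `⊤` to `0`; the first quotient `γ / 2` is always
  -- finite.
  have htop : D ≠ ⊤ := by
    refine ne_top_of_le_ne_top (ENNReal.div_ne_top ENNReal.ofReal_ne_top ?_) h1
    exact (ENNReal.ofReal_pos.2 two_pos).ne'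
  exact ⟨ENNReal.toReal_pos hpos.ne' htop,
    toReal_mul_le_of_le_quot hγ.le h1, toReal_mul_le_of_le_quot zero_le_one h2,
    toReal_mul_le_of_le_quot (mul_pos hγ hσ).le h3,
    toReal_mul_le_of_le_quot (mul_pos hMQ hσ).le h4,
    toReal_mul_le_of_le_quot (pow_pos hσ 2).le h5⟩

theorem localBounds (hp : 0 < p) (hXc : IsClosed X) (hX : Convex ℝ X) (hc : IsConstraintMap c)
    {τ : ℝ≥0 → ℝ≥0} (hτmono : StrictMono τ) (hτ0 : τ 0 = 0)
    (hLτ : ∀ t : ℝ≥0, t ≤ 1 → (τ t : ℝ) ≤ Lτ * t) (hρ : IsProjectiveMapping X W ρ)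
    (hξ : ∀ y, 0 ≤ ξ y) (hx : x ∈ feasibleSet X c) (hnd : Nondegenerate X c x) :
    LocalBounds X c W τ x (gam X c W x) (Mc X c W x) (MQ X c W x) (Mxi X c W ξ x)
      (Lc X c W x) Lτ (sigmaQ c W x) (del X c W ρ ξ Lτ x) := by
  have hσ := sigmaQ_pos hp hX hx.1 (hρ.isPositive x hx.1) (hρ.ker_eq x hx.1) hnd
  have hσc := sigmac_pos hp hX hx.1 (hρ.ker_eq x hx.1) hnd
  have hγ := gam_pos hp hc hρ.continuousOn hx.1 hσ
  have hMc := Mc_pos hp hc hγ hσc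
  have hMQ := MQ_pos hp hXc hρ.continuousOn hx.1 hγ hσ
  have hT : 0 < Lτ := by
    have h1 := hLτ 1 le_rfl
    have h2 : (0 : ℝ) < τ 1 := by
      rw [NNReal.coe_pos, ← hτ0]; exact hτmono one_pos
    rw [NNReal.coe_one, mul_one] at h1
    exact h2.trans_le h1
  have hK : 0 ≤ Mxi X c W ξ x := Mxi_nonneg hξ
  have hR : 0 ≤ Lrho X c W ρ x := Lrho_nonneg hρ.nonneg
  obtain ⟨hδ, h1, h2, h3, h4, h5⟩ := del_spec (ρ := ρ) (ξ := ξ) (Lτ := Lτ) hγ hσc hσ hMQ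
  refine ⟨hc.differentiable, hx.2, hρ.isPositive, hLτ, hMc, hMQ, hK, Lc_nonneg, hT, hσ, hδ,
    fun y hy q => ?_, fun y hy => norm_nablac_le_Mc hc hy,
    fun y hy => norm_le_MQ hXc hρ.continuousOn hy,
    fun y hy z hz => norm_nablac_sub_le_Lc hc hy hz, by linarith, h2, h3, ?_, ?_⟩
  · refine le_trans (mul_le_mul_of_nonneg_right ?_ (norm_nonneg q)) (sigmaMin_mul_norm_le _ q)
    refine sigmaQ_div_two_le hγ hy.1 ?_
    have := mem_closedBall_iff_norm.1 hy.2
    linarith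
  · refine le_of_mul_le_mul_right (le_trans ?_ h4) hσ
    have : 0 ≤ del X c W ρ ξ Lτ x * (4 * Lrho X c W ρ x * Mc X c W x ^ 2) := by positivity
    linarith
  · refine le_trans (mul_le_mul_of_nonneg_left (mul_le_mul_of_nonneg_right ?_ ?_) hδ.le) h5
    · have : 0 ≤ 12 * Lrho X c W ρ x * Mc X c W x ^ 3 := by positivity
      linarith
    · positivity

end constants

/-! ### Convergence of the iterates and existence of an admissible `ξ`. -/

section

variable {n p : ℕ} {X : Set (E n)} {c : E n → E p} {W : E n → E n →L[ℝ] E n}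
  {τ : ℝ≥0 → ℝ≥0} {x : E n}

namespace LocalBounds

variable {γ M N K L T σ δ : ℝ} (h : LocalBounds X c W τ x γ M N K L T σ δ)

include h

theorem radius_pos : 0 < σ / (32 * N * M ^ 2 + 2 * σ) * δ := by
  have hσ := h.σ_pos
  have hN := h.N_pos
  have hM := h.M_pos
  have hδ := h.δ_pos
  positivity

/-- Extracted from the last term of `δ`. It ties `δ` to the size of `ξ`, so that enlarging `ξ`
shrinks `Ω_x` enough for mirror steps to exist. -/
theorem four_mul_le_one : 4 * M ^ 2 * K * δ ≤ 1 := by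
  have hσ := h.σ_pos
  have hN := h.N_pos
  have hM := h.M_pos
  have hT := h.T_pos
  have hL := h.L_nonneg
  have hδ := h.δ_pos
  have h1 : 0 ≤ δ * ((2 * T * σ + 2 * L * N ^ 2 * M ^ 2) * (2 * M)) := by positivity
  have h2 := h.δ_mul_sum_le
  refine le_of_mul_le_mul_left ?_ (pow_pos hσ 2)
  linarith

theorem iterate_mem {S : Set (E n)} (hS : S ⊆ X) {u : ℕ → E n} (h0S : u 0 ∈ S)
    (h0 : ‖u 0 - x‖ ≤ σ / (32 * N * M ^ 2 + 2 * σ) * δ)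
    (hu : ∀ k, u k ∈ S → u k ∈ Metric.closedBall x δ →
      u (k + 1) ∈ S ∧ ‖dissolve c W τ (u k) - u (k + 1)‖ ≤ K * ‖c (u k)‖ ^ 2) (k : ℕ) :
    u k ∈ S ∧ ‖u k - x‖ ≤ δ / 2 := by
  have hσ := h.σ_pos
  have hN := h.N_pos
  have hM := h.M_pos
  have hδ := h.δ_pos
  set δ' := σ / (32 * N * M ^ 2 + 2 * σ) * δ with hδ'
  have hδ'0 : 0 < δ' := h.radius_pos
  have hδ'eq : δ' * (32 * N * M ^ 2 + 2 * σ) = σ * δ := by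
    rw [hδ']; field_simp
  have hδ'le : δ' ≤ δ := by
    have h1 : 0 ≤ δ' * (32 * N * M ^ 2 + σ) := by positivity
    refine le_of_mul_le_mul_left ?_ hσ
    linarith
  have hc0 : ‖c (u 0)‖ ≤ M * δ' := by
    refine (h.norm_apply_le (h.closedBall_subset ?_)).trans
      (mul_le_mul_of_nonneg_left h0 hM.le)
    exact mem_closedBall_iff_norm.2 (h0.trans hδ'le)
  -- The step bounds are at most `4NM/σ · M δ' · 2⁻ʲ`, with total at most twice the first; this is
  -- what the denominator of `δ'` is made for.
  have hrad : δ' + 4 * N * M / σ * (2 * (M * δ')) ≤ δ / 2 := by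
    have h1 : δ' + 4 * N * M / σ * (2 * (M * δ')) = δ' * (σ + 8 * N * M ^ 2) / σ := by
      field_simp; ring
    rw [h1, div_le_iff₀ hσ]
    have h2 : 0 ≤ δ' * (8 * N * M ^ 2) := by positivity
    linarith
  -- The factor `2 - 2 (1/2)^k` is the partial sum of the first `k` powers of `1/2`.
  have key : ∀ k, u k ∈ S ∧ ‖u k - x‖ ≤ δ / 2 ∧ ‖c (u k)‖ ≤ ‖c (u 0)‖ * (1 / 2) ^ k ∧
      ‖u k - x‖ ≤ δ' + 4 * N * M / σ * (‖c (u 0)‖ * (2 - 2 * (1 / 2) ^ k)) := by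
    intro k
    induction k with
    | zero =>
      refine ⟨h0S, h0.trans (le_trans ?_ hrad), by simp, by simpa using h0⟩
      have : 0 ≤ 4 * N * M / σ * (2 * (M * δ')) := by positivity
      linarith
    | succ k ih =>
      obtain ⟨hkS, hkδ, hkc, hkx⟩ := ih
      have hball : u k ∈ Metric.closedBall x δ := mem_closedBall_iff_norm.2 (by linarith)
      obtain ⟨hS1, herr⟩ := hu k hkS hball
      have hstep := h.norm_step_sub_le ⟨hS hkS, hball⟩ herr
      have hhalf := h.norm_apply_step_le_half ⟨hS hkS, hball⟩ herr
      have htri := norm_sub_le_norm_sub_add_norm_sub (u (k + 1)) (u k) x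
      have h1 : 4 * N * M / σ * ‖c (u k)‖ ≤ 4 * N * M / σ * (‖c (u 0)‖ * (1 / 2) ^ k) := by
        gcongr
      have h2 : ‖u (k + 1) - x‖
          ≤ δ' + 4 * N * M / σ * (‖c (u 0)‖ * (2 - 2 * (1 / 2) ^ (k + 1))) := by
        rw [pow_succ]
        linarith
      refine ⟨hS1, h2.trans (le_trans ?_ hrad), ?_, h2⟩
      · have h3 : ‖c (u 0)‖ * (2 - 2 * (1 / 2) ^ (k + 1)) ≤ 2 * (M * δ') := by
          have h4 : 0 ≤ ‖c (u 0)‖ * (1 / 2) ^ (k + 1) := by positivity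
          linarith
        gcongr
      · rw [pow_succ]
        linarith
  exact ⟨(key k).1, (key k).2.1⟩

/-- Geometric decay restarted at each `k` bounds the remaining path by twice the first step bound,
which is the constant `8NM/σ`. -/
theorem exists_tendsto (hX : IsClosed X) {u : ℕ → E n} (huX : ∀ k, u k ∈ X)
    (hux : ∀ k, ‖u k - x‖ ≤ δ / 2)
    (hu : ∀ k, ‖dissolve c W τ (u k) - u (k + 1)‖ ≤ K * ‖c (u k)‖ ^ 2) :
    ∃ xs ∈ X, ‖xs - x‖ ≤ δ ∧ c xs = 0 ∧ Tendsto u atTop (𝓝 xs) ∧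
      ∀ k, ‖u k - xs‖ ≤ 8 * N * M / σ * ‖c (u k)‖ := by
  have hσ := h.σ_pos
  have hN := h.N_pos
  have hM := h.M_pos
  have hδ := h.δ_pos
  have hmem : ∀ k, u k ∈ X ∩ Metric.closedBall x δ := fun k =>
    ⟨huX k, mem_closedBall_iff_norm.2 ((hux k).trans (by linarith))⟩
  have hgeom : ∀ k m, ‖c (u (k + m))‖ ≤ ‖c (u k)‖ * (1 / 2) ^ m := by
    intro k m
    induction m with
    | zero => simp
    | succ m ih =>
      have := h.norm_apply_step_le_half (hmem (k + m)) (hu (k + m))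
      rw [pow_succ]
      rw [add_assoc] at this
      linarith
  have hdist : ∀ k m, dist (u (k + m)) (u (k + (m + 1)))
      ≤ 4 * N * M / σ * ‖c (u k)‖ * (1 / 2) ^ m := by
    intro k m
    rw [dist_comm, dist_eq_norm]
    have h1 := h.norm_step_sub_le (hmem (k + m)) (hu (k + m))
    rw [add_assoc] at h1
    refine h1.trans ?_
    rw [mul_assoc _ ‖c (u k)‖]
    exact mul_le_mul_of_nonneg_left (hgeom k m) (by positivity)
  have hcauchy : CauchySeq u := by
    refine cauchySeq_of_le_geometric (1 / 2) (4 * N * M / σ * ‖c (u 0)‖) (by norm_num)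
      fun m => ?_
    simpa using hdist 0 m
  obtain ⟨xs, hxs⟩ := cauchySeq_tendsto_of_complete hcauchy
  have hc0 : Tendsto (fun k => c (u k)) atTop (𝓝 0) := by
    refine squeeze_zero_norm (a := fun k => ‖c (u 0)‖ * (1 / 2) ^ k)
      (fun k => by simpa using hgeom 0 k) ?_
    have := (tendsto_pow_atTop_nhds_zero_of_lt_one (r := (1 / 2 : ℝ)) (by norm_num)
      (by norm_num)).const_mul ‖c (u 0)‖
    rwa [mul_zero] at this
  refine ⟨xs, hX.mem_of_tendsto hxs (Eventually.of_forall huX),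
    mem_closedBall_iff_norm.1 (Metric.isClosed_closedBall.mem_of_tendsto hxs
      (Eventually.of_forall fun k => (hmem k).2)),
    tendsto_nhds_unique ((h.differentiable.continuous.tendsto xs).comp hxs) hc0, hxs,
    fun k => ?_⟩
  have hshift : Tendsto (fun m => u (k + m)) atTop (𝓝 xs) := by
    simpa [add_comm] using (tendsto_add_atTop_iff_nat k).2 hxs
  have := dist_le_of_le_geometric_of_tendsto₀ (1 / 2) (4 * N * M / σ * ‖c (u k)‖) (by norm_num)
    (hdist k) hshift
  rw [dist_eq_norm] at this
  exact this.trans_eq (by ring)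

theorem norm_apply_le_mul_infDist (hx : x ∈ X) {y : E n} (hy : ‖y - x‖ ≤ δ / 2) :
    ‖c y‖ ≤ M * Metric.infDist y (feasibleSet X c) := by
  have hM := h.M_pos
  have hδ := h.δ_pos
  have hγ := h.two_mul_δ_le
  have hyγ : y ∈ Metric.closedBall x γ := mem_closedBall_iff_norm.2 (by linarith)
  have hne : (feasibleSet X c).Nonempty := ⟨x, hx, h.apply_eq_zero⟩
  rw [← div_le_iff₀' hM, Metric.le_infDist hne]
  intro w hw
  rw [div_le_iff₀' hM, dist_eq_norm]
  -- The Lipschitz bound is known only on the `γ`-ball. A feasible point outside it is farther from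
  -- `y` than `x` is, and `x` is itself feasible.
  by_cases hwγ : w ∈ Metric.closedBall x γ
  · have := h.norm_sub_le hwγ hyγ
    rwa [show c w = 0 from hw.2, sub_zero] at this
  · refine (h.norm_apply_le hyγ).trans (mul_le_mul_of_nonneg_left ?_ hM.le)
    rw [mem_closedBall_iff_norm, not_le] at hwγ
    have := norm_sub_le_norm_sub_add_norm_sub w y x
    rw [norm_sub_rev w y] at this
    linarith

theorem exists_quadratic_limit (hXc : IsClosed X) (hx : x ∈ X) :
    ∃ C : ℝ, ∀ u : ℕ → E n, (∀ k, u k ∈ X) → (∀ k, ‖u k - x‖ ≤ δ / 2) →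
      (∀ k, ‖dissolve c W τ (u k) - u (k + 1)‖ ≤ K * ‖c (u k)‖ ^ 2) →
      ∃ xs ∈ X ∩ Metric.closedBall x δ ∩ feasibleSet X c, Tendsto u atTop (𝓝 xs) ∧
        (∀ k, ‖u (k + 1) - xs‖ ≤ C * ‖u k - xs‖ ^ 2) ∧
        ∀ k, Metric.infDist (u (k + 1)) (feasibleSet X c) ≤
          C * Metric.infDist (u k) (feasibleSet X c) ^ 2 := by
  have hσ := h.σ_pos
  have hN := h.N_pos
  have hM := h.M_pos
  have hT := h.T_pos
  have hL := h.L_nonneg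
  have hK := h.K_nonneg
  have hδ := h.δ_pos
  set A := 2 * T / σ + 2 * L * N ^ 2 * M ^ 2 / σ ^ 2 + M * K with hA
  -- The product of the three estimates: distance to the limit by `‖c‖`, quadratic decrease of
  -- `‖c‖`, and `‖c‖ ≤ M r` squared. It does not depend on the sequence.
  refine ⟨8 * N * M / σ * (A * M ^ 2), fun u huX hux hu => ?_⟩
  obtain ⟨xs, hxsX, hxsδ, hxs0, hlim, hle⟩ := h.exists_tendsto hXc huX hux hu
  have hxsK : xs ∈ feasibleSet X c := ⟨hxsX, hxs0⟩
  have hmem : ∀ k, u k ∈ X ∩ Metric.closedBall x δ := fun k =>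
    ⟨huX k, mem_closedBall_iff_norm.2 ((hux k).trans (by linarith))⟩
  have hstep : ∀ k r, ‖c (u k)‖ ≤ M * r →
      ‖u (k + 1) - xs‖ ≤ 8 * N * M / σ * (A * M ^ 2) * r ^ 2 := by
    intro k r hr
    calc ‖u (k + 1) - xs‖ ≤ 8 * N * M / σ * ‖c (u (k + 1))‖ := hle (k + 1)
      _ ≤ 8 * N * M / σ * (A * ‖c (u k)‖ ^ 2) := by
          gcongr
          exact h.norm_apply_step_le (hmem k) (hu k)
      _ ≤ 8 * N * M / σ * (A * (M * r) ^ 2) := by gcongr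
      _ = 8 * N * M / σ * (A * M ^ 2) * r ^ 2 := by ring
  refine ⟨xs, ⟨⟨hxsX, mem_closedBall_iff_norm.2 hxsδ⟩, hxsK⟩, hlim, fun k => hstep k _ ?_,
    fun k => ?_⟩
  · have := h.norm_sub_le (h.closedBall_subset (mem_closedBall_iff_norm.2 hxsδ))
      (h.closedBall_subset (hmem k).2)
    rwa [hxs0, sub_zero] at this
  · refine (Metric.infDist_le_dist_of_mem hxsK).trans ?_
    rw [dist_eq_norm]
    exact hstep k _ (h.norm_apply_le_mul_infDist hx (hux k))

end LocalBounds

variable {φ : E n → EReal}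

/-- `Ω_x` depends on `ξ`, but `gam`, `Mc` and `sigmaQ` do not, so a constant `B` can be fixed
beforehand. Its second summand is the expansion error; the first, `N / σ`, serves only to shrink `δ`
until `N ‖d‖ < 1`, as local inversion of `∇φ` requires. -/
theorem exists_isErrorBound (hp : 0 < p) (hXc : IsClosed X) (hX : Convex ℝ X)
    (hc : IsConstraintMap c) (hτmono : StrictMono τ) (hτ0 : τ 0 = 0) {Lτ : ℝ}
    (hLτ : ∀ t : ℝ≥0, t ≤ 1 → (τ t : ℝ) ≤ Lτ * t)
    (hφ : IsProjectiveBregmanKernel X φ W) {ρ : E n → ℝ} (hρ : IsProjectiveMapping X W ρ)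
    (hx : x ∈ feasibleSet X c) (hnd : Nondegenerate X c x) :
    ∃ ξ : E n → ℝ, IsErrorBound X c φ W τ Lτ ρ x ξ := by
  -- Radius `2` covers unit balls around points of `Ω_x`, since `δ ≤ 1`.
  obtain ⟨N, L, hN, hL, hWN, hWL⟩ := hφ.exists_norm_le_and_lipschitz hXc x 2
  -- The choice `ξ = 0` only supplies positivity of constants independent of `ξ`.
  have hb0 := localBounds (ξ := 0) hp hXc hX hc hτmono hτ0 hLτ hρ (fun _ => le_rfl) hx hnd
  have hσ := hb0.σ_pos
  have hM := hb0.M_pos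
  have hγ : 0 < gam X c W x := by linarith [hb0.δ_pos, hb0.two_mul_δ_le]
  set σ := sigmaQ c W x
  set M := Mc X c W x
  set B := N / σ + L * N * (2 * M / σ) ^ 2 with hB
  have hB0 : 0 ≤ B := by positivity
  have hlocal : LocallyBoundedOn univ fun _ : E n => B := fun _ _ _ => ⟨|B|, fun _ _ => le_rfl⟩
  refine ⟨fun _ => B, fun _ => hB0, hlocal, ?_⟩
  have h := localBounds (ξ := fun _ => B) hp hXc hX hc hτmono hτ0 hLτ hρ (fun _ => hB0) hx hnd
  rintro y ⟨hy, hyX⟩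
  have hδ := h.δ_pos
  have hδ1 : del X c W ρ (fun _ => B) Lτ x ≤ 1 := by
    linarith [h.two_mul_δ_le, gam_le_one hγ]
  have hBle : B ≤ Mxi X c W (fun _ => B) x := le_Mxi hlocal (mem_ballx_self hγ)
  have hyx := mem_closedBall_iff_norm.1 hy.2
  have hsub : Metric.closedBall y 1 ∩ interior X ⊆ X ∩ Metric.closedBall x 2 := by
    rintro z ⟨hz, hzX⟩
    refine ⟨interior_subset hzX, mem_closedBall_iff_norm.2 ?_⟩
    have := norm_sub_le_norm_sub_add_norm_sub z y x
    have := mem_closedBall_iff_norm.1 hz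
    linarith
  have hyB : y ∈ X ∩ Metric.closedBall x 2 :=
    hsub ⟨Metric.mem_closedBall_self zero_le_one, hyX⟩
  have hdir := h.norm_dir_le hy
  have hsmall : N * ‖-dir c W τ y‖ < 1 := by
    have h1 : N / σ ≤ Mxi X c W (fun _ => B) x := by
      refine le_trans ?_ hBle
      have : 0 ≤ L * N * (2 * M / σ) ^ 2 := by positivity
      linarith
    calc N * ‖-dir c W τ y‖ ≤ N * (2 * M / σ * (M * del X c W ρ (fun _ => B) Lτ x)) := by
          rw [norm_neg]
          gcongr
          refine hdir.trans ?_
          gcongr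
          exact h.norm_apply_le_mul_δ hy.2
      _ = 2 * M ^ 2 * (N / σ) * del X c W ρ (fun _ => B) Lτ x := by ring
      _ ≤ 2 * M ^ 2 * Mxi X c W (fun _ => B) x * del X c W ρ (fun _ => B) Lτ x := by gcongr
      _ < 1 := by linarith [h.four_mul_le_one]
  obtain ⟨z, hz, hgrad, hzy⟩ := hφ.exists_grad_eq_norm_sub_le hX hyX hN hL
    (fun z hz => hWN z (hsub hz)) (fun z hz => hWL z (hsub hz) y hyB) hsmall
  refine ⟨z, hφ.isMirrorStep_iff.2 ⟨hz, by rw [hgrad, sub_eq_add_neg]⟩, ?_⟩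
  rw [map_neg, norm_neg, sub_neg_eq_add] at hzy
  rw [dissolve, norm_sub_rev, ← sub_add]
  calc ‖z - y + W y (dir c W τ y)‖ ≤ L * N * ‖dir c W τ y‖ ^ 2 := hzy
    _ ≤ L * N * (2 * M / σ * ‖c y‖) ^ 2 := by gcongr
    _ = L * N * (2 * M / σ) ^ 2 * ‖c y‖ ^ 2 := by ring
    _ ≤ B * ‖c y‖ ^ 2 := by
        gcongr
        have : 0 ≤ N / σ := by positivity
        linarith

theorem exists_quadratic_convergence (hp : 0 < p) (hXc : IsClosed X) (hX : Convex ℝ X)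
    (hc : IsConstraintMap c) (hτmono : StrictMono τ) (hτ0 : τ 0 = 0) {Lτ : ℝ}
    (hLτ : ∀ t : ℝ≥0, t ≤ 1 → (τ t : ℝ) ≤ Lτ * t)
    (hφ : IsProjectiveBregmanKernel X φ W) {ρ : E n → ℝ} (hρ : IsProjectiveMapping X W ρ)
    (hx : x ∈ feasibleSet X c) (hnd : Nondegenerate X c x) {ξ : E n → ℝ}
    (hξ : IsErrorBound X c φ W τ Lτ ρ x ξ) :
    0 < del X c W ρ ξ Lτ x ∧ 0 < del' X c W ρ ξ Lτ x ∧
    ∃ C : ℝ, ∀ x₀ ∈ Xi X c W ρ ξ Lτ x ∩ interior X,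
      ∃ u : ℕ → E n,
        (∀ v : ℕ → E n,
          (v 0 = x₀ ∧ ∀ k, IsMirrorStep φ (dir c W τ (v k)) (v k) (v (k + 1))) ↔ v = u) ∧
        (∀ v : ℕ → E n,
          (v 0 = x₀ ∧ ∀ k, IsProxStep φ (dir c W τ (v k)) (v k) (v (k + 1))) ↔ v = u) ∧
        ∃ xs ∈ Omega X c W ρ ξ Lτ x ∩ feasibleSet X c,
          Tendsto u atTop (𝓝 xs) ∧
          (∀ k, ‖u (k + 1) - xs‖ ≤ C * ‖u k - xs‖ ^ 2) ∧
          (∀ k, Metric.infDist (u (k + 1)) (feasibleSet X c) ≤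
            C * Metric.infDist (u k) (feasibleSet X c) ^ 2) := by
  have h := localBounds hp hXc hX hc hτmono hτ0 hLτ hρ hξ.nonneg hx hnd
  obtain ⟨C, hC⟩ := h.exists_quadratic_limit hXc hx.1
  refine ⟨h.δ_pos, h.radius_pos, C, ?_⟩
  rintro x₀ ⟨hx₀, hx₀X⟩
  choose! s hs hsξ using hξ.bound
  set u : ℕ → E n := fun k => s^[k] x₀ with hu
  have hu0 : u 0 = x₀ := rfl
  have hus : ∀ k, u (k + 1) = s (u k) := fun k => Function.iterate_succ_apply' s k x₀
  have herr : ∀ y ∈ Omega X c W ρ ξ Lτ x ∩ interior X,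
      ‖dissolve c W τ y - s y‖ ≤ Mxi X c W ξ x * ‖c y‖ ^ 2 := fun y hy =>
    (hsξ y hy).trans (mul_le_mul_of_nonneg_right
      (le_Mxi hξ.locallyBounded (h.closedBall_subset hy.1.2)) (sq_nonneg _))
  have hmem := h.iterate_mem interior_subset (u := u) hx₀X
    (mem_closedBall_iff_norm.1 hx₀.2) fun k hk hkδ => by
      have hk' : u k ∈ Omega X c W ρ ξ Lτ x ∩ interior X := ⟨⟨interior_subset hk, hkδ⟩, hk⟩
      rw [hus]
      exact ⟨(hφ.isMirrorStep_iff.1 (hs _ hk')).1, herr _ hk'⟩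
  have hΩ : ∀ k, u k ∈ Omega X c W ρ ξ Lτ x ∩ interior X := fun k =>
    ⟨⟨interior_subset (hmem k).1,
      mem_closedBall_iff_norm.2 ((hmem k).2.trans (half_le_self h.δ_pos.le))⟩, (hmem k).1⟩
  have hmirror : ∀ k, IsMirrorStep φ (dir c W τ (u k)) (u k) (u (k + 1)) := fun k => by
    rw [hus]; exact hs _ (hΩ k)
  have hunique : ∀ v : ℕ → E n,
      (v 0 = x₀ ∧ ∀ k, IsMirrorStep φ (dir c W τ (v k)) (v k) (v (k + 1))) ↔ v = u := by
    intro v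
    constructor
    · rintro ⟨hv0, hv⟩
      funext k
      induction k with
      | zero => exact hv0
      | succ k ih =>
        have := hv k
        rw [ih] at this
        exact hφ.isMirrorStep_unique this (hmirror k)
    · rintro rfl
      exact ⟨hu0, hmirror⟩
  refine ⟨u, hunique, fun v => ?_, ?_⟩
  · rw [← hunique v]
    refine and_congr_right fun hv0 => ?_
    constructor
    · intro hv
      -- The equivalence of the two steps needs an interior base point; each proximal step lands in
      -- the interior, so this propagates by induction.
      have hint : ∀ k, v k ∈ interior X := by
        intro k
        induction k with
        | zero => rw [hv0]; exact hx₀X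
        | succ k ih => exact (hφ.isMirrorStep_iff.1 ((hφ.isProxStep_iff ih).1 (hv k))).1
      exact fun k => (hφ.isProxStep_iff (hint k)).1 (hv k)
    · intro hv
      have hvu := (hunique v).1 ⟨hv0, hv⟩
      exact fun k => (hφ.isProxStep_iff (by rw [hvu]; exact (hmem k).1)).2 (hv k)
  · exact hC u (fun k => interior_subset (hmem k).1) (fun k => (hmem k).2) fun k => by
      rw [hus]; exact herr _ (hΩ k)

end

end Feasibility

theorem mainTheorem4 {n p : ℕ} (hp : 0 < p)
    (X : Set (E n)) (hXclosed : IsClosed X) (hXconvex : Convex ℝ X)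
    (c : E n → E p) (hc : IsConstraintMap c)
    (τ : ℝ≥0 → ℝ≥0) (hτlip : LocallyLipschitz τ) (hτmono : StrictMono τ) (hτ0 : τ 0 = 0)
    (Lτ : ℝ) (hLτ : ∀ t : ℝ≥0, t ≤ 1 → (τ t : ℝ) ≤ Lτ * t)
    (φ : E n → EReal) (W : E n → E n →L[ℝ] E n) (hφ : IsProjectiveBregmanKernel X φ W)
    (x : E n) (hx : x ∈ feasibleSet X c) (hxnd : Nondegenerate X c x) :
    (∃ ρ : E n → ℝ, IsProjectiveMapping X W ρ) ∧
    (∀ ρ : E n → ℝ, IsProjectiveMapping X W ρ →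
      (∃ ξ : E n → ℝ, IsErrorBound X c φ W τ Lτ ρ x ξ) ∧
      ∀ ξ : E n → ℝ, IsErrorBound X c φ W τ Lτ ρ x ξ →
        0 < del X c W ρ ξ Lτ x ∧ 0 < del' X c W ρ ξ Lτ x ∧
        ∃ C : ℝ, ∀ x₀ ∈ Xi X c W ρ ξ Lτ x ∩ interior X,
          ∃ u : ℕ → E n,
            (∀ v : ℕ → E n,
              (v 0 = x₀ ∧ ∀ k, IsMirrorStep φ (dir c W τ (v k)) (v k) (v (k + 1))) ↔ v = u) ∧
            (∀ v : ℕ → E n,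
              (v 0 = x₀ ∧ ∀ k, IsProxStep φ (dir c W τ (v k)) (v k) (v (k + 1))) ↔ v = u) ∧
            ∃ xs ∈ Omega X c W ρ ξ Lτ x ∩ feasibleSet X c,
              Tendsto u atTop (𝓝 xs) ∧
              (∀ k, ‖u (k + 1) - xs‖ ≤ C * ‖u k - xs‖ ^ 2) ∧
              (∀ k, Metric.infDist (u (k + 1)) (feasibleSet X c) ≤
                C * Metric.infDist (u k) (feasibleSet X c) ^ 2)) :=
  ⟨hφ.exists_isProjectiveMapping hXclosed hXconvex, fun _ hρ =>
    ⟨exists_isErrorBound hp hXclosed hXconvex hc hτmono hτ0 hLτ hφ hρ hx hxnd, fun _ hξ =>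
      exists_quadratic_convergence hp hXclosed hXconvex hc hτmono hτ0 hLτ hφ hρ hx hxnd hξ⟩⟩
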